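/- Let $K$ be a field of characteristic $0$, let $V_1$ be the $SL_2(K)$-module of binary linear forms, and let $\mathcal I = K[5V_1]^{SL_2}$ be the algebra of $SL_2(K)$-invariant polynomial functions on quintuples $(\ell_1,\dots,\ell_5)$ of binary linear forms $\ell_i = a_{i0}x + a_{i1}y$, graded by total degree in the coefficients. (1) The ten brackets $[ij] = a_{i0}a_{j1}-a_{i1}a_{j0}$, $1\le i<j\le 5$, form a minimal system of homogeneous generators of $\mathcal I$ (they are homogeneous of degree $2$, generate $\mathcal I$, and none lies in the subalgebra generated by the others). (2) The kernel of the $K$-algebra homomorphism $K[x_{ij} : 1\le i<j\le 5]\to\mathcal I$, $x_{ij}\mapsto [ij]$, is generated as an ideal by the five Plücker relations of $G(2,5)$ $$x_{ij}x_{kl}-x_{ik}x_{jl}+x_{il}x_{jk},\qquad 1\le i<j<k<l\le 5,$$ that is, by the $4\times4$ sub-Pfaffians of the generic skew-symmetric $5\times 5$ matrix, and none of the five lies in the ideal generated by the others. (3) Let $f_1,\dots,f_m$ be any minimal system of homogeneous generators of $\mathcal I$. Then $m=10$ and $\deg f_s=2$ for all $s$. Let $R=K[x_1,\dots,x_{10}]$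 with $\deg x_s=\deg f_s=2$, and regard $\mathcal I$ as an $R$-module through the homomorphism $\varphi\colon R\to\mathcal I$, $x_s\mapsto f_s$. Then $\mathcal I$ has a minimal graded free resolution of the form $$0\longrightarrow R(-10)\longrightarrow R(-6)^5\longrightarrow R(-4)^5\longrightarrow R\stackrel{\varphi}{\longrightarrow}\mathcal I\longrightarrow 0,$$ that is, an exact sequence of degree-preserving $R$-linear maps in which the image of each map between free modules is contained in $(x_1,\dots,x_{10})$ times its target. The projective dimension of the $R$-module $\mathcal I$ is $3$. -/

import Mathlib

open MvPolynomial Matrix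

noncomputable section

namespace FiveLinearForms

universe u

/-- The binary linear form `a 0 * x + a 1 * y` with coefficient vector `a`. -/
def linearForm {K : Type u} [Field K] (a : Fin 2 → K) : MvPolynomial (Fin 2) K :=
  ∑ b, C (a b) * X b

/-- The action of `SL₂(K)` on binary forms by the linear substitution `(x, y) ↦ (x, y) g`. -/
def substitute {K : Type u} [Field K] (g : Matrix.SpecialLinearGroup (Fin 2) K) :
    MvPolynomial (Fin 2) K →ₐ[K] MvPolynomial (Fin 2) K :=
  aeval fun b => ∑ c, C ((g : Matrix (Fin 2) (Fin 2) K) c b) * X c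

/-- On coefficient vectors of linear forms, the substitution action is `a ↦ g a`. -/
theorem substitute_linearForm {K : Type u} [Field K] (g : Matrix.SpecialLinearGroup (Fin 2) K)
    (a : Fin 2 → K) :
    substitute g (linearForm a) = linearForm ((g : Matrix (Fin 2) (Fin 2) K) *ᵥ a) := by
  simp [substitute, linearForm, Matrix.mulVec, dotProduct, Fin.sum_univ_two]
  ring

/-- The algebra `K[n V₁]^{SL₂}` of invariant polynomial functions on `n`-tuples of binary linear
forms; the variable `(i, b)` is the `b`-th coefficient of the `i`-th form. -/
def invariants (K : Type u) [Field K] (n : ℕ) :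
    Subalgebra K (MvPolynomial (Fin n × Fin 2) K) where
  carrier := {p | ∀ (g : Matrix.SpecialLinearGroup (Fin 2) K) (v : Fin n → Fin 2 → K),
    eval (fun q => ((g : Matrix (Fin 2) (Fin 2) K) *ᵥ v q.1) q.2) p
      = eval (fun q => v q.1 q.2) p}
  mul_mem' := by
    intro p q hp hq g v
    rw [map_mul, map_mul, hp g v, hq g v]
  add_mem' := by
    intro p q hp hq g v
    rw [map_add, map_add, hp g v, hq g v]
  algebraMap_mem' := by
    intro r g v
    simp [MvPolynomial.algebraMap_eq]

/-- The bracket `[i j]`, the determinant of the coefficients of the `i`-th and `j`-th form. -/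
def bracket (K : Type u) [Field K] {n : ℕ} (i j : Fin n) : invariants K n :=
  ⟨X (i, 0) * X (j, 1) - X (i, 1) * X (j, 0), by
    intro g v
    have h : g.1 0 0 * g.1 1 1 - g.1 0 1 * g.1 1 0 = 1 := by
      rw [← Matrix.det_fin_two]; exact g.2
    simp only [map_sub, map_mul, eval_X, Matrix.mulVec, dotProduct, Fin.sum_univ_two]
    linear_combination (v i 0 * v j 1 - v i 1 * v j 0) * h⟩

/-- The index set `{(i, j) : i < j}` of the ten brackets of five linear forms. -/
abbrev Pair : Type := {p : Fin 5 × Fin 5 // p.1 < p.2}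

/-- The family of the ten brackets `[i j]`, `i < j`. -/
def brackets (K : Type u) [Field K] : Pair → invariants K 5 :=
  fun p => bracket K p.1.1 p.1.2

/-- The generic skew-symmetric `5 × 5` matrix in the variables `x_{ij}`, `i < j`. -/
def genericSkew (K : Type u) [Field K] : Matrix (Fin 5) (Fin 5) (MvPolynomial Pair K) :=
  fun i j => if h : i < j then X ⟨(i, j), h⟩ else if h : j < i then -X ⟨(j, i), h⟩ else 0

/-- The Pfaffian of a skew-symmetric `4 × 4` matrix. -/
def pfaffianFour {R : Type*} [CommRing R] (A : Matrix (Fin 4) (Fin 4) R) : R :=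
  A 0 1 * A 2 3 - A 0 2 * A 1 3 + A 0 3 * A 1 2

/-- The Plücker relation of `G(2,5)` belonging to the four indices different from `h`: the Pfaffian
of the generic skew-symmetric matrix with row and column `h` removed. -/
def plucker (K : Type u) [Field K] (h : Fin 5) : MvPolynomial Pair K :=
  pfaffianFour ((genericSkew K).submatrix h.succAbove h.succAbove)

/-- `f` is a minimal system of homogeneous generators, of degrees `deg`, of the algebra `A`. -/
structure IsMinimalGenerators {K : Type u} [Field K] {τ : Type*}
    {A : Subalgebra K (MvPolynomial τ K)} {σ : Type*} (f : σ → A) (deg : σ → ℕ) : Prop where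
  homogeneous : ∀ s, (f s : MvPolynomial τ K).IsHomogeneous (deg s)
  generates : Algebra.adjoin K (Set.range f) = ⊤
  irredundant : ∀ s, f s ∉ Algebra.adjoin K (f '' {s}ᶜ)

/-- The elements of degree `n` of an algebra of polynomials, graded by total degree (with degrees
in `ℤ`; only `0` has negative degree). -/
def algebraDegree {K : Type u} [Field K] {τ : Type*} (A : Subalgebra K (MvPolynomial τ K)) (n : ℤ) :
    Set A :=
  {x | IsWeightedHomogeneous (fun _ : τ => (1 : ℤ)) (x : MvPolynomial τ K) n}

/-- The elements of degree `n` of the graded free module `⨁ₐ R(-t a)` over the polynomial ring `R`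
whose variables have the degrees `w`. -/
def freeDegree {K : Type u} [Field K] {σ : Type*} (w : σ → ℤ) {ι : Type*} (t : ι → ℤ) (n : ℤ) :
    Set (ι → MvPolynomial σ K) :=
  {v | ∀ a, IsWeightedHomogeneous w (v a) (n - t a)}

/-- A minimal graded free resolution, with terms of finite rank,
`⋯ ⟶ F₂ ⟶ F₁ ⟶ F₀ ⟶ M ⟶ 0` of the module `M`, where `Fᵢ = ⨁ₐ R(-twist i a)`. The set `gr n`
consists of the elements of degree `n` of `M`, and `w` gives the (positive) degrees of the
variables of `R`. -/
structure MinimalGradedFreeResolution {K : Type u} [Field K] {σ : Type*} (w : σ → ℤ)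
    (M : Type*) [AddCommGroup M] [Module (MvPolynomial σ K) M] (gr : ℤ → Set M) where
  rank : ℕ → ℕ
  twist : ∀ i, Fin (rank i) → ℤ
  d : ∀ i, (Fin (rank (i + 1)) → MvPolynomial σ K) →ₗ[MvPolynomial σ K]
    (Fin (rank i) → MvPolynomial σ K)
  aug : (Fin (rank 0) → MvPolynomial σ K) →ₗ[MvPolynomial σ K] M
  d_graded : ∀ i n, Set.MapsTo (d i) (freeDegree w (twist (i + 1)) n) (freeDegree w (twist i) n)
  aug_graded : ∀ n, Set.MapsTo aug (freeDegree w (twist 0) n) (gr n)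
  exact_d : ∀ i, Function.Exact (d (i + 1)) (d i)
  exact_aug : Function.Exact (d 0) aug
  aug_surjective : Function.Surjective aug
  minimal : ∀ i v a, d i v a ∈ Ideal.span (Set.range (X : σ → MvPolynomial σ K))

/-- The `i`-th term of the resolution is `R(-j)^r`. -/
def MinimalGradedFreeResolution.TermIs {K : Type u} [Field K] {σ : Type*} {w : σ → ℤ}
    {M : Type*} [AddCommGroup M] [Module (MvPolynomial σ K) M] {gr : ℤ → Set M}
    (F : MinimalGradedFreeResolution (K := K) w M gr) (i : ℕ) (j : ℤ) (r : ℕ) : Prop :=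
  F.rank i = r ∧ ∀ a, F.twist i a = j

/-- The structure of a module over `R = K[x_s : s ∈ σ]` on an algebra `A` that is given by
`x_s ↦ f s`. -/
abbrev moduleVia {K : Type u} [Field K] {A : Type*} [CommRing A] [Algebra K A] {σ : Type*}
    (f : σ → A) : Module (MvPolynomial σ K) A :=
  Module.compHom A (aeval f : MvPolynomial σ K →ₐ[K] A).toRingHom

end FiveLinearForms

end

open FiveLinearForms

noncomputable section

namespace FiveLinearForms

universe u

/-! The candidate resolution is the Buchsbaum–Eisenbud complex of the generic skew-symmetric
$5\times5$ matrix $A$: the row of signed $4\times4$ Pfaffians, $A$ itself, and the column of the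
same Pfaffians. By graded Nakayama (`matExact_of_killVar`), exactness at the two middle terms
follows once it holds after setting some variables to zero. Killing five of the ten variables leaves
a pentagon whose Pfaffians are monomials, and there the relations are solved by hand. The
intermediate specializations also show that $x_{01}$ is a nonzerodivisor modulo the Pfaffian ideal
$I$, and $x_{02}$ modulo $I+(x_{01})$ (`mem_span_pfVec_of_X_mul_mem`).

These two facts give both fundamental theorems. Where $[01]\neq0$, every zero of $I$ is the bracket
point of explicit vectors and is parametrized by free coordinates; since $x_{01}$ can be cancelled
modulo $I$, a polynomial vanishing at all bracket points lies in $I$ (`mem_pfIdeal_of_vanishing`).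
The same argument with $x_{02}$ handles the locus $[01]=0$ (`mem_pfIdeal_sup_of_vanishing`). An
invariant $f$ is a polynomial in brackets up to a power of $[01]$, by moving the first two vectors
to standard position. If $[01]^{N+1}f=G$ in brackets, then $G$ vanishes where $[01]=0$, so $G\in
I+(x_{01})$ and one factor $[01]$ cancels; induction on $N$ gives generation.

For arbitrary minimal generators, invariants have no linear part, so the quadratic part behaves like
a derivation at the origin. Hence the degree-2 generators already span the brackets, every generator
has degree 2, and two minimal systems differ by a linear change of coordinates, which transports the
resolution. The projective dimension is 3 because the last map has entries without constant term and
so cannot split (`BracketCoordinates.not_projective`). -/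

/-- The columns of `M` generate all relations `N *ᵥ u = 0`. -/
def MatExact {R : Type*} [CommRing R] {ι κ μ : Type*} [Fintype ι] [Fintype κ]
    (N : Matrix μ ι R) (M : Matrix ι κ R) : Prop :=
  ∀ u, N *ᵥ u = 0 → ∃ w, M *ᵥ w = u

/-! ### Homogeneous components, setting a variable to zero, and graded Nakayama. -/

section Homogeneous

variable {K : Type u} [Field K] {σ : Type*}

theorem homogeneousComponent_mul_of_isHomogeneous {a : ℕ} {m : MvPolynomial σ K}
    (hm : m.IsHomogeneous a) (n : ℕ) (w : MvPolynomial σ K) :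
    homogeneousComponent (n + a) (m * w) = m * homogeneousComponent n w := by
  conv_lhs => rw [← sum_homogeneousComponent w]
  rw [Finset.mul_sum, map_sum]
  have hterm : ∀ i, homogeneousComponent (n + a) (m * homogeneousComponent i w) =
      if i = n then m * homogeneousComponent n w else 0 := by
    intro i
    have h : (m * homogeneousComponent i w).IsHomogeneous (a + i) :=
      hm.mul (homogeneousComponent_isHomogeneous i w)
    rw [homogeneousComponent_of_mem h]
    by_cases hi : i = n
    · subst hi; simp [add_comm]
    · rw [if_neg (by omega), if_neg hi]
  rw [Finset.sum_congr rfl fun i _ => hterm i, Finset.sum_ite_eq']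
  split_ifs with h
  · rfl
  · rw [homogeneousComponent_eq_zero _ _ (by simpa using h), mul_zero]

theorem homogeneousComponent_mul_of_lt {a n : ℕ} {m : MvPolynomial σ K}
    (hm : m.IsHomogeneous a) (hn : n < a) (w : MvPolynomial σ K) :
    homogeneousComponent n (m * w) = 0 := by
  conv_lhs => rw [← sum_homogeneousComponent w]
  rw [Finset.mul_sum, map_sum]
  refine Finset.sum_eq_zero fun i _ => ?_
  have h : (m * homogeneousComponent i w).IsHomogeneous (a + i) :=
    hm.mul (homogeneousComponent_isHomogeneous i w)
  rw [homogeneousComponent_of_mem h, if_neg (by omega)]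

theorem homogeneousComponent_mulVec {ι κ : Type*} [Fintype κ] {a : ℕ}
    {M : Matrix ι κ (MvPolynomial σ K)} (hM : ∀ i j, (M i j).IsHomogeneous a) (n : ℕ)
    (w : κ → MvPolynomial σ K) (i : ι) :
    homogeneousComponent (n + a) ((M *ᵥ w) i) =
      (M *ᵥ fun j => homogeneousComponent n (w j)) i := by
  simp only [mulVec, dotProduct, map_sum]
  exact Finset.sum_congr rfl fun j _ => homogeneousComponent_mul_of_isHomogeneous (hM i j) n _

theorem homogeneousComponent_mulVec_of_lt {ι κ : Type*} [Fintype κ] {a n : ℕ}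
    {M : Matrix ι κ (MvPolynomial σ K)} (hM : ∀ i j, (M i j).IsHomogeneous a) (hn : n < a)
    (w : κ → MvPolynomial σ K) (i : ι) :
    homogeneousComponent n ((M *ᵥ w) i) = 0 := by
  simp only [mulVec, dotProduct, map_sum]
  exact Finset.sum_eq_zero fun j _ => homogeneousComponent_mul_of_lt (hM i j) hn _

/-- It suffices to test exactness of homogeneous matrices on homogeneous vectors. -/
theorem matExact_of_homogeneous {ι κ μ : Type*} [Fintype ι] [Fintype κ] {b : ℕ}
    {N : Matrix μ ι (MvPolynomial σ K)} {M : Matrix ι κ (MvPolynomial σ K)}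
    (hN : ∀ i j, (N i j).IsHomogeneous b)
    (h : ∀ (n : ℕ) (u : ι → MvPolynomial σ K), (∀ i, (u i).IsHomogeneous n) → N *ᵥ u = 0 →
      ∃ w, M *ᵥ w = u) : MatExact N M := by
  intro u hu
  have hcomp : ∀ n, ∃ w, M *ᵥ w = fun i => homogeneousComponent n (u i) := fun n =>
    h n _ (fun i => homogeneousComponent_isHomogeneous n (u i)) (by
      funext i
      rw [← homogeneousComponent_mulVec hN, hu]
      simp)
  choose w hw using hcomp
  let d := Finset.univ.sup fun i => (u i).totalDegree
  refine ⟨∑ n ∈ Finset.range (d + 1), w n, ?_⟩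
  have hsum : M *ᵥ (∑ n ∈ Finset.range (d + 1), w n) =
      ∑ n ∈ Finset.range (d + 1), M *ᵥ w n := map_sum M.mulVecLin _ _
  rw [hsum]
  funext i
  rw [Finset.sum_apply]
  simp only [hw]
  conv_rhs => rw [← sum_homogeneousComponent (u i)]
  symm
  refine Finset.sum_subset (Finset.range_mono ?_) fun n _ hn =>
    homogeneousComponent_eq_zero _ _ (by simpa using hn)
  exact Nat.succ_le_succ (Finset.le_sup (f := fun i => (u i).totalDegree) (Finset.mem_univ i))

variable [DecidableEq σ]

/-- The substitution `X x ↦ 0`. -/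
def killVar (x : σ) : MvPolynomial σ K →ₐ[K] MvPolynomial σ K :=
  aeval (Function.update X x 0)

@[simp] theorem killVar_X_self (x : σ) : killVar x (X x : MvPolynomial σ K) = 0 := by
  simp [killVar]

theorem killVar_X (x y : σ) :
    killVar x (X y : MvPolynomial σ K) = if y = x then 0 else X y := by
  simp [killVar, Function.update_apply]

theorem X_dvd_sub_killVar (x : σ) (f : MvPolynomial σ K) : X x ∣ f - killVar x f := by
  induction f using MvPolynomial.induction_on with
  | C a => simp [killVar]
  | add p q hp hq =>
    rw [map_add, add_sub_add_comm]
    exact dvd_add hp hq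
  | mul_X p y hp =>
    rw [map_mul, killVar_X]
    split_ifs with h
    · subst h; simp
    · rw [← sub_mul]; exact hp.mul_right _

theorem X_dvd_iff_killVar (x : σ) (f : MvPolynomial σ K) : X x ∣ f ↔ killVar x f = 0 := by
  constructor
  · rintro ⟨g, rfl⟩
    simp
  · intro h
    simpa [h] using X_dvd_sub_killVar x f

theorem map_mulVec_apply {R S ι κ : Type*} [CommRing R] [CommRing S] [Fintype κ] (φ : R →+* S)
    (M : Matrix ι κ R) (w : κ → R) (i : ι) :
    φ ((M *ᵥ w) i) = (M.map φ *ᵥ fun j => φ (w j)) i := by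
  simp [mulVec, dotProduct, map_sum]

theorem killVar_killVar (x : σ) (f : MvPolynomial σ K) :
    killVar x (killVar x f) = killVar x f := by
  have h := (X_dvd_iff_killVar x _).1 (X_dvd_sub_killVar x f)
  rw [map_sub, sub_eq_zero] at h
  exact h.symm

/-- If the specialization at `X x = 0` is exact, a relation is a combination of columns
modulo `X x`. -/
theorem exists_eq_mulVec_add_of_matExact {ι κ μ : Type*} [Fintype ι] [Fintype κ] (x : σ)
    {N : Matrix μ ι (MvPolynomial σ K)} {M : Matrix ι κ (MvPolynomial σ K)}
    (h : MatExact (N.map (killVar x : MvPolynomial σ K →ₐ[K] _))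
      (M.map (killVar x : MvPolynomial σ K →ₐ[K] _)))
    (u : ι → MvPolynomial σ K) (hu : ∀ i, X x ∣ (N *ᵥ u) i) :
    ∃ (w : κ → MvPolynomial σ K) (v : ι → MvPolynomial σ K),
      ∀ i, u i = (M *ᵥ w) i + X x * v i := by
  obtain ⟨w, hw⟩ := h (fun i => killVar x (u i)) (by
    funext i
    have h1 := map_mulVec_apply (killVar x : MvPolynomial σ K →ₐ[K] _).toRingHom N u i
    have h2 := (X_dvd_iff_killVar x _).1 (hu i)
    rw [Pi.zero_apply]
    exact h1.symm.trans h2)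
  have hdvd : ∀ i, X x ∣ u i - (M *ᵥ w) i := by
    intro i
    rw [X_dvd_iff_killVar, map_sub, sub_eq_zero]
    have h0 : killVar x (u i) = (M.map (killVar x) *ᵥ w) i := (congrFun hw i).symm
    have h1 := map_mulVec_apply (killVar x : MvPolynomial σ K →ₐ[K] _).toRingHom
      (M.map (killVar x)) w i
    have h2 := map_mulVec_apply (killVar x : MvPolynomial σ K →ₐ[K] _).toRingHom M w i
    have h3 : (M.map (killVar x : MvPolynomial σ K →ₐ[K] _)).map
        (killVar x : MvPolynomial σ K →ₐ[K] _).toRingHom =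
        M.map (killVar x : MvPolynomial σ K →ₐ[K] _).toRingHom := by
      ext1 i j
      exact killVar_killVar x (M i j)
    rw [h3] at h1
    have h4 := h1.trans h2.symm
    have h5 := congrArg (killVar x) h0
    rw [killVar_killVar] at h5
    exact h5.trans h4
  choose v hv using hdvd
  exact ⟨w, v, fun i => by rw [← hv]; ring⟩

/-- Graded Nakayama: a complex of homogeneous matrices that is exact after setting a variable to
zero is exact. -/
theorem matExact_of_killVar {ι κ μ : Type*} [Fintype ι] [Fintype κ] (x : σ) {a b : ℕ}
    {N : Matrix μ ι (MvPolynomial σ K)} {M : Matrix ι κ (MvPolynomial σ K)}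
    (hN : ∀ i j, (N i j).IsHomogeneous b) (hM : ∀ i j, (M i j).IsHomogeneous a)
    (hNM : N * M = 0)
    (h : MatExact (N.map (killVar x : MvPolynomial σ K →ₐ[K] _))
      (M.map (killVar x : MvPolynomial σ K →ₐ[K] _))) : MatExact N M := by
  refine matExact_of_homogeneous hN fun n => ?_
  induction n with
  | zero =>
    intro u hu hNu
    obtain ⟨w, v, hwv⟩ := exists_eq_mulVec_add_of_matExact x h u (by simp [hNu])
    rcases Nat.eq_zero_or_pos a with rfl | ha
    · refine ⟨fun j => homogeneousComponent 0 (w j), funext fun i => ?_⟩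
      have h1 := congrArg (homogeneousComponent 0) (hwv i)
      rw [homogeneousComponent_eq_self (hu i), map_add,
        homogeneousComponent_mul_of_lt (isHomogeneous_X K x) Nat.zero_lt_one, add_zero] at h1
      rw [h1]
      exact (homogeneousComponent_mulVec hM 0 w i).symm
    · refine ⟨0, funext fun i => ?_⟩
      have h1 := congrArg (homogeneousComponent 0) (hwv i)
      rw [homogeneousComponent_eq_self (hu i), map_add,
        homogeneousComponent_mul_of_lt (isHomogeneous_X K x) Nat.zero_lt_one, add_zero,
        homogeneousComponent_mulVec_of_lt hM ha] at h1
      simp [h1]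
  | succ n ih =>
    intro u hu hNu
    obtain ⟨w, v, hwv⟩ := exists_eq_mulVec_add_of_matExact x h u (by simp [hNu])
    obtain ⟨w', hw'⟩ : ∃ w' : κ → MvPolynomial σ K,
        ∀ i, homogeneousComponent (n + 1) ((M *ᵥ w) i) = (M *ᵥ w') i := by
      by_cases ha : n + 1 < a
      · exact ⟨0, fun i => by rw [homogeneousComponent_mulVec_of_lt hM ha]; simp⟩
      · obtain ⟨k, hk⟩ := Nat.exists_eq_add_of_le' (not_lt.1 ha)
        exact ⟨fun j => homogeneousComponent k (w j), fun i => by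
          rw [hk, homogeneousComponent_mulVec hM]⟩
    have key : ∀ i, u i = (M *ᵥ w') i + X x * homogeneousComponent n (v i) := by
      intro i
      have h1 := congrArg (homogeneousComponent (n + 1)) (hwv i)
      rwa [homogeneousComponent_eq_self (hu i), map_add, hw',
        homogeneousComponent_mul_of_isHomogeneous (isHomogeneous_X K x)] at h1
    -- Since $NM=0$ and $X_x$ is a nonzerodivisor, the remainder is again a relation, of degree one
    -- less, so the induction hypothesis applies to it.
    obtain ⟨v', hv'⟩ := ih (fun i => homogeneousComponent n (v i))
      (fun i => homogeneousComponent_isHomogeneous _ _) (by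
        have hu' : u = M *ᵥ w' + (X x : MvPolynomial σ K) • fun i => homogeneousComponent n (v i) := by
          funext i
          simpa using key i
        rw [hu', mulVec_add, mulVec_mulVec, hNM, zero_mulVec, zero_add, mulVec_smul] at hNu
        exact (smul_eq_zero.1 hNu).resolve_left (X_ne_zero x))
    refine ⟨w' + (X x : MvPolynomial σ K) • v', ?_⟩
    rw [mulVec_add, mulVec_smul, hv']
    funext i
    simp [key i]

end Homogeneous

/-! ### The skew-symmetric matrix and its Pfaffians. -/

section Pfaffians

variable {S : Type*} [CommRing S]

/-- The pair `i < j`. -/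
abbrev pr (i j : Fin 5) (h : i < j := by decide) : Pair := ⟨(i, j), h⟩

/-- The skew-symmetric matrix with entries `x` above the diagonal. -/
def skewOf (x : Pair → S) : Matrix (Fin 5) (Fin 5) S :=
  fun i j => if h : i < j then x ⟨(i, j), h⟩ else if h : j < i then -x ⟨(j, i), h⟩ else 0

/-- The `4 × 4` sub-Pfaffians of `skewOf x`, with alternating signs. -/
def pfVec (x : Pair → S) (h : Fin 5) : S :=
  (-1) ^ (h : ℕ) * pfaffianFour ((skewOf x).submatrix h.succAbove h.succAbove)

/-- The row of signed Pfaffians. -/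
def pfRow (x : Pair → S) : Matrix (Fin 1) (Fin 5) S := fun _ h => pfVec x h

/-- The column of signed Pfaffians. -/
def pfCol (x : Pair → S) : Matrix (Fin 5) (Fin 1) S := fun h _ => pfVec x h

theorem skewOf_eq (x : Pair → S) : skewOf x =
    !![0, x (pr 0 1), x (pr 0 2), x (pr 0 3), x (pr 0 4);
      -x (pr 0 1), 0, x (pr 1 2), x (pr 1 3), x (pr 1 4);
      -x (pr 0 2), -x (pr 1 2), 0, x (pr 2 3), x (pr 2 4);
      -x (pr 0 3), -x (pr 1 3), -x (pr 2 3), 0, x (pr 3 4);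
      -x (pr 0 4), -x (pr 1 4), -x (pr 2 4), -x (pr 3 4), 0] := by
  ext i j
  fin_cases i <;> fin_cases j <;> simp [skewOf, pr]

theorem pfVec_eq (x : Pair → S) : pfVec x =
    ![x (pr 1 2) * x (pr 3 4) - x (pr 1 3) * x (pr 2 4) + x (pr 1 4) * x (pr 2 3),
      -(x (pr 0 2) * x (pr 3 4) - x (pr 0 3) * x (pr 2 4) + x (pr 0 4) * x (pr 2 3)),
      x (pr 0 1) * x (pr 3 4) - x (pr 0 3) * x (pr 1 4) + x (pr 0 4) * x (pr 1 3),
      -(x (pr 0 1) * x (pr 2 4) - x (pr 0 2) * x (pr 1 4) + x (pr 0 4) * x (pr 1 2)),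
      x (pr 0 1) * x (pr 2 3) - x (pr 0 2) * x (pr 1 3) + x (pr 0 3) * x (pr 1 2)] := by
  ext h
  fin_cases h <;> simp [pfVec, pfaffianFour, skewOf_eq, Fin.succAbove, Fin.lt_def]
  · ring
  · ring

/-- Up to sign, each entry expands the Pfaffian of the $6\times6$ skew matrix obtained by repeating
one row and column, which is zero. The alternating signs in `pfVec` are there for this. -/
theorem pfRow_mul_skewOf (x : Pair → S) : pfRow x * skewOf x = 0 := by
  ext i j
  fin_cases j <;> simp [pfRow, pfVec_eq, skewOf_eq, Matrix.mul_apply, Fin.sum_univ_five] <;> ring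

theorem skewOf_mul_pfCol (x : Pair → S) : skewOf x * pfCol x = 0 := by
  ext i j
  fin_cases i <;> simp [pfCol, pfVec_eq, skewOf_eq, Matrix.mul_apply, Fin.sum_univ_five] <;> ring

theorem skewOf_map {T : Type*} [CommRing T] (φ : S →+* T) (x : Pair → S) :
    (skewOf x).map φ = skewOf fun p => φ (x p) := by
  ext i j
  simp only [skewOf, Matrix.map_apply]
  split_ifs <;> simp

theorem map_pfVec {T : Type*} [CommRing T] (φ : S →+* T) (x : Pair → S) (h : Fin 5) :
    φ (pfVec x h) = pfVec (fun p => φ (x p)) h := by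
  simp only [pfVec, ← skewOf_map φ x, pfaffianFour]
  simp

theorem pfRow_map {T : Type*} [CommRing T] (φ : S →+* T) (x : Pair → S) :
    (pfRow x).map φ = pfRow fun p => φ (x p) := by
  ext i j
  exact map_pfVec φ x j

theorem pfCol_map {T : Type*} [CommRing T] (φ : S →+* T) (x : Pair → S) :
    (pfCol x).map φ = pfCol fun p => φ (x p) := by
  ext i j
  exact map_pfVec φ x i

end Pfaffians

/-! ### Exactness of the Pfaffian complex by specialization to a pentagon. -/

section Exactness

variable (K : Type u) [Field K]

/-- The generic point, with the coordinates in `T` set to zero. -/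
def genericPoint (T : Finset Pair) : Pair → MvPolynomial Pair K :=
  fun p => if p ∈ T then 0 else X p

theorem killVar_genericPoint (T : Finset Pair) (x : Pair) :
    (fun p => killVar x (genericPoint K T p)) = genericPoint K (insert x T) := by
  funext p
  simp only [genericPoint, Finset.mem_insert]
  by_cases hT : p ∈ T
  · simp [hT]
  · simp [hT, killVar_X]

theorem genericPoint_isHomogeneous (T : Finset Pair) (p : Pair) :
    (genericPoint K T p).IsHomogeneous 1 := by
  unfold genericPoint
  split_ifs
  · exact isHomogeneous_zero _ _ _
  · exact isHomogeneous_X _ _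

variable {K}

theorem skewOf_isHomogeneous {σ : Type*} {x : Pair → MvPolynomial σ K}
    (hx : ∀ p, (x p).IsHomogeneous 1) (i j : Fin 5) : (skewOf x i j).IsHomogeneous 1 := by
  unfold skewOf
  split_ifs
  · exact hx _
  · exact (hx _).neg
  · exact isHomogeneous_zero _ _ _

theorem pfVec_isHomogeneous {σ : Type*} {x : Pair → MvPolynomial σ K}
    (hx : ∀ p, (x p).IsHomogeneous 1) (h : Fin 5) : (pfVec x h).IsHomogeneous 2 := by
  have hm : ∀ a b c d, (skewOf x a b * skewOf x c d).IsHomogeneous 2 := fun a b c d =>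
    (skewOf_isHomogeneous hx a b).mul (skewOf_isHomogeneous hx c d)
  have hp : (pfaffianFour ((skewOf x).submatrix h.succAbove h.succAbove)).IsHomogeneous 2 :=
    ((hm _ _ _ _).sub (hm _ _ _ _)).add (hm _ _ _ _)
  unfold pfVec
  rcases neg_one_pow_eq_or (MvPolynomial σ K) (h : ℕ) with hs | hs
  · rw [hs, one_mul]; exact hp
  · rw [hs, neg_one_mul]; exact hp.neg

variable (K)

/-- Exactness at the two middle terms for the generic point with the coordinates in `T` killed. -/
def MiddleExact (T : Finset Pair) : Prop :=
  MatExact (pfRow (genericPoint K T)) (skewOf (genericPoint K T)) ∧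
    MatExact (skewOf (genericPoint K T)) (pfCol (genericPoint K T))

variable {K}

theorem pfRow_map_killVar (T : Finset Pair) (x : Pair) :
    (pfRow (genericPoint K T)).map (killVar x : MvPolynomial Pair K →ₐ[K] _) =
      pfRow (genericPoint K (insert x T)) :=
  (pfRow_map (killVar x : MvPolynomial Pair K →ₐ[K] _).toRingHom _).trans
    (congrArg pfRow (killVar_genericPoint K T x))

theorem skewOf_map_killVar (T : Finset Pair) (x : Pair) :
    (skewOf (genericPoint K T)).map (killVar x : MvPolynomial Pair K →ₐ[K] _) =
      skewOf (genericPoint K (insert x T)) :=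
  (skewOf_map (killVar x : MvPolynomial Pair K →ₐ[K] _).toRingHom _).trans
    (congrArg skewOf (killVar_genericPoint K T x))

theorem pfCol_map_killVar (T : Finset Pair) (x : Pair) :
    (pfCol (genericPoint K T)).map (killVar x : MvPolynomial Pair K →ₐ[K] _) =
      pfCol (genericPoint K (insert x T)) :=
  (pfCol_map (killVar x : MvPolynomial Pair K →ₐ[K] _).toRingHom _).trans
    (congrArg pfCol (killVar_genericPoint K T x))

theorem MiddleExact.of_insert {T : Finset Pair} (x : Pair) (h : MiddleExact K (insert x T)) :
    MiddleExact K T := by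
  have hs := skewOf_isHomogeneous (genericPoint_isHomogeneous K T)
  have hp := pfVec_isHomogeneous (genericPoint_isHomogeneous K T)
  refine ⟨matExact_of_killVar x (fun _ j => hp j) hs (pfRow_mul_skewOf _) ?_,
    matExact_of_killVar x hs (fun j _ => hp j) (skewOf_mul_pfCol _) ?_⟩
  · rw [pfRow_map_killVar, skewOf_map_killVar]
    exact h.1
  · rw [skewOf_map_killVar, pfCol_map_killVar]
    exact h.2

theorem X_dvd_of_dvd_X_mul {σ : Type*} {x y : σ} (hxy : x ≠ y) {f : MvPolynomial σ K}
    (h : X x ∣ X y * f) : X x ∣ f :=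
  (X_prime.dvd_or_dvd h).resolve_left fun h' => hxy (X_dvd_X.1 h')

/-- The Koszul relation for the regular sequence of two distinct variables. -/
theorem eq_of_X_mul_add_X_mul_eq_zero {σ : Type*} {x y : σ} (hxy : x ≠ y)
    {f g : MvPolynomial σ K} (h : X x * f + X y * g = 0) :
    ∃ c, f = X y * c ∧ g = -(X x * c) := by
  obtain ⟨c, hc⟩ : X y ∣ f :=
    X_dvd_of_dvd_X_mul hxy.symm ⟨-g, by linear_combination h⟩
  refine ⟨c, hc, ?_⟩
  subst hc
  refine mul_left_cancel₀ (X_ne_zero y) ?_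
  linear_combination h

/-- The five diagonals of a pentagon. -/
def diagonals : Finset Pair := {pr 0 1, pr 0 2, pr 1 3, pr 2 4, pr 3 4}

theorem skewOf_diagonals : skewOf (genericPoint K diagonals) =
    !![0, 0, 0, X (pr 0 3), X (pr 0 4);
      0, 0, X (pr 1 2), 0, X (pr 1 4);
      0, -X (pr 1 2), 0, X (pr 2 3), 0;
      -X (pr 0 3), 0, -X (pr 2 3), 0, 0;
      -X (pr 0 4), -X (pr 1 4), 0, 0, 0] := by
  rw [skewOf_eq]
  simp [genericPoint, diagonals, pr]

/-- The surviving edges form the pentagon 0-3-2-1-4. Deleting a vertex leaves a path on four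
vertices with exactly one perfect matching, so each Pfaffian is a monomial. -/
theorem pfVec_diagonals : pfVec (genericPoint K diagonals) =
    ![X (pr 1 4) * X (pr 2 3), -(X (pr 0 4) * X (pr 2 3)), -(X (pr 0 3) * X (pr 1 4)),
      -(X (pr 0 4) * X (pr 1 2)), X (pr 0 3) * X (pr 1 2)] := by
  rw [pfVec_eq]
  simp [genericPoint, diagonals, pr]

/-- Every row has two nonzero entries, so every equation is a two-variable Koszul relation. Rows 3
and 4 make `v 0` divisible by $x_{23}x_{14}$, and the quotient determines the other coordinates
around the pentagon. -/
theorem matExact_skewOf_diagonals :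
    MatExact (skewOf (genericPoint K diagonals)) (pfCol (genericPoint K diagonals)) := by
  intro v hv
  rw [skewOf_diagonals] at hv
  have e0 := congrFun hv 0
  have e1 := congrFun hv 1
  have e2 := congrFun hv 2
  have e3 := congrFun hv 3
  have e4 := congrFun hv 4
  simp [mulVec, dotProduct, Fin.sum_univ_five] at e0 e1 e2 e3 e4
  obtain ⟨a, ha⟩ : X (pr 2 3) ∣ v 0 :=
    X_dvd_of_dvd_X_mul (y := pr 0 3) (by decide) ⟨-v 2, by linear_combination -e3⟩
  obtain ⟨r, hr⟩ : X (pr 1 4) ∣ a :=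
    X_dvd_of_dvd_X_mul (y := pr 2 3) (by decide) (by
      rw [← ha]
      exact X_dvd_of_dvd_X_mul (y := pr 0 4) (by decide) ⟨-v 1, by linear_combination -e4⟩)
  subst hr
  have h2 : v 2 = -(X (pr 0 3) * X (pr 1 4)) * r :=
    mul_left_cancel₀ (X_ne_zero (pr 2 3)) (by rw [ha] at e3; linear_combination -e3)
  have h1 : v 1 = -(X (pr 0 4) * X (pr 2 3)) * r :=
    mul_left_cancel₀ (X_ne_zero (pr 1 4)) (by rw [ha] at e4; linear_combination -e4)
  have h3 : v 3 = -(X (pr 0 4) * X (pr 1 2)) * r :=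
    mul_left_cancel₀ (X_ne_zero (pr 2 3)) (by rw [h1] at e2; linear_combination e2)
  have h4 : v 4 = X (pr 0 3) * X (pr 1 2) * r :=
    mul_left_cancel₀ (X_ne_zero (pr 1 4)) (by rw [h2] at e1; linear_combination e1)
  refine ⟨fun _ => r, ?_⟩
  funext i
  fin_cases i <;> simp [pfCol, mulVec, dotProduct, pfVec_diagonals, ha, h1, h2, h3, h4]
  ring

theorem matExact_pfRow_diagonals :
    MatExact (pfRow (genericPoint K diagonals)) (skewOf (genericPoint K diagonals)) := by
  intro u hu
  have e := congrFun hu 0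
  simp [pfRow, pfVec_diagonals, mulVec, dotProduct, Fin.sum_univ_five] at e
  rw [skewOf_diagonals]
  -- Modulo $x_{03}$ and $x_{04}$ the relation reads $x_{14}x_{23}u_0=0$, so $u_0=x_{03}a+x_{04}b$.
  obtain ⟨a, ha⟩ := X_dvd_sub_killVar (pr 0 3) (u 0)
  obtain ⟨b, hb⟩ := X_dvd_sub_killVar (pr 0 4) (killVar (pr 0 3) (u 0))
  have h0 : killVar (pr 0 4) (killVar (pr 0 3) (u 0)) = 0 := by
    have := congrArg (fun f => killVar (pr 0 4) (killVar (pr 0 3) f)) e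
    simpa [killVar_X, pr] using this
  have hu0 : u 0 = X (pr 0 3) * a + X (pr 0 4) * b := by
    linear_combination ha + hb + h0
  obtain ⟨q1, hq1⟩ := X_dvd_sub_killVar (pr 1 2) (u 1 - X (pr 1 4) * b)
  obtain ⟨q2, hq2⟩ := X_dvd_sub_killVar (pr 1 2) (u 2 - X (pr 2 3) * a)
  set s1 := killVar (pr 1 2) (u 1 - X (pr 1 4) * b) with hs1
  set s2 := killVar (pr 1 2) (u 2 - X (pr 2 3) * a) with hs2
  have hk1 : killVar (pr 1 2) s1 = s1 := killVar_killVar _ _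
  have hk2 : killVar (pr 1 2) s2 = s2 := killVar_killVar _ _
  -- The relation is now $x_{03}(\cdot)+x_{04}(\cdot)=0$. Splitting off multiples of $x_{12}$ leaves
  -- `s1` and `s2` free of that variable, so that setting $x_{12}=0$ isolates them.
  obtain ⟨c, hc1, hc2⟩ := eq_of_X_mul_add_X_mul_eq_zero (x := pr 0 3) (y := pr 0 4) (by decide)
    (f := X (pr 1 2) * (u 4 - X (pr 1 4) * q2) - X (pr 1 4) * s2)
    (g := -(X (pr 1 2) * (u 3 + X (pr 2 3) * q1)) - X (pr 2 3) * s1) (by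
      have f1 : u 1 = s1 + X (pr 1 4) * b + X (pr 1 2) * q1 := by linear_combination hq1
      have f2 : u 2 = s2 + X (pr 2 3) * a + X (pr 1 2) * q2 := by linear_combination hq2
      rw [hu0, f1, f2] at e
      linear_combination e)
  have hd1 := congrArg (killVar (pr 1 2)) hc1
  have hd2 := congrArg (killVar (pr 1 2)) hc2
  simp [killVar_X, pr, hk1, hk2] at hd1 hd2
  obtain ⟨s, hs2', hκ⟩ := eq_of_X_mul_add_X_mul_eq_zero (x := pr 1 4) (y := pr 0 4) (by decide)
    (f := s2) (g := killVar (pr 1 2) c) (by linear_combination -hd1)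
  rw [hκ] at hd2
  obtain ⟨t, hs1', hst⟩ := eq_of_X_mul_add_X_mul_eq_zero (x := pr 2 3) (y := pr 0 3) (by decide)
    (f := s1) (g := X (pr 1 4) * s) (by linear_combination hd2)
  obtain ⟨r, hr, ht⟩ := eq_of_X_mul_add_X_mul_eq_zero (x := pr 1 4) (y := pr 2 3) (by decide)
    (f := s) (g := t) (by linear_combination hst)
  subst hr ht
  -- The relations at $x_{12}=0$ give $s_2=x_{04}x_{23}r$, $s_1=-x_{03}x_{14}r$ and
  -- $c\equiv-x_{14}x_{23}r$ modulo $x_{12}$. The quotient `m` then determines $u_3$ and $u_4$.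
  obtain ⟨m, hm⟩ : X (pr 1 2) ∣ c + X (pr 1 4) * X (pr 2 3) * r :=
    X_dvd_of_dvd_X_mul (y := pr 0 4) (by decide)
      ⟨u 4 - X (pr 1 4) * q2, by linear_combination -hc1 - X (pr 1 4) * hs2'⟩
  have h4 : u 4 - X (pr 1 4) * q2 = X (pr 0 4) * m :=
    mul_left_cancel₀ (X_ne_zero (pr 1 2))
      (by linear_combination hc1 + X (pr 1 4) * hs2' + X (pr 0 4) * hm)
  have h3 : u 3 + X (pr 2 3) * q1 = X (pr 0 3) * m :=
    mul_left_cancel₀ (X_ne_zero (pr 1 2))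
      (by linear_combination -hc2 - X (pr 2 3) * hs1' + X (pr 0 3) * hm)
  refine ⟨![-m, -q2, q1, a + X (pr 0 4) * r, b - X (pr 0 3) * r], ?_⟩
  funext i
  fin_cases i <;> simp [mulVec, dotProduct, Fin.sum_univ_five]
  · linear_combination -hu0
  · linear_combination -hq1 - hs1'
  · linear_combination -hq2 - hs2'
  · linear_combination -h3
  · linear_combination -h4

theorem middleExact_diagonals : MiddleExact K diagonals :=
  ⟨matExact_pfRow_diagonals, matExact_skewOf_diagonals⟩

theorem middleExact_pair : MiddleExact K {pr 0 2, pr 0 1} := by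
  refine .of_insert (pr 1 3) (.of_insert (pr 2 4) (.of_insert (pr 3 4) ?_))
  rw [show insert (pr 3 4) (insert (pr 2 4) (insert (pr 1 3) {pr 0 2, pr 0 1})) = diagonals by
    decide]
  exact middleExact_diagonals

theorem middleExact_singleton : MiddleExact K {pr 0 1} := middleExact_pair.of_insert (pr 0 2)

theorem middleExact_empty : MiddleExact K ∅ := by
  refine .of_insert (pr 0 1) ?_
  rw [insert_empty_eq]
  exact middleExact_singleton

theorem mem_span_pfVec_iff {S : Type*} [CommRing S] {x : Pair → S} {f : S} :
    f ∈ Ideal.span (Set.range (pfVec x)) ↔ ∃ u, (pfRow x *ᵥ u) 0 = f := by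
  rw [Ideal.mem_span_range_iff_exists_fun]
  simp [pfRow, mulVec, dotProduct, mul_comm]

/-- A killable variable is not a zero divisor modulo the Pfaffians. -/
theorem mem_span_pfVec_of_X_mul_mem {T : Finset Pair} {x : Pair}
    (h : MiddleExact K (insert x T)) {f : MvPolynomial Pair K}
    (hf : X x * f ∈ Ideal.span (Set.range (pfVec (genericPoint K T)))) :
    f ∈ Ideal.span (Set.range (pfVec (genericPoint K T))) := by
  rw [mem_span_pfVec_iff] at hf ⊢
  obtain ⟨u, hu⟩ := hf
  -- The coefficient vector is a relation modulo $X_x$, hence a combination of columns of the skew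
  -- matrix plus $X_x v$. The Pfaffian row kills the columns, and $X_x$ cancels.
  obtain ⟨w, v, hwv⟩ := exists_eq_mulVec_add_of_matExact (N := pfRow (genericPoint K T))
    (M := skewOf (genericPoint K T)) x
    (by rw [pfRow_map_killVar, skewOf_map_killVar]; exact h.1) u (by
      intro i
      rw [Subsingleton.elim i 0, hu]
      exact dvd_mul_right _ _)
  refine ⟨v, mul_left_cancel₀ (X_ne_zero x) ?_⟩
  have hu' : u = skewOf (genericPoint K T) *ᵥ w + (X x : MvPolynomial Pair K) • v := by
    funext i
    simpa using hwv i
  rw [hu', mulVec_add, mulVec_mulVec, pfRow_mul_skewOf, zero_mulVec, zero_add, mulVec_smul] at hu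
  simpa using hu

end Exactness

/-! ### Membership in an ideal from vanishing on a parametrized open set. -/

section Elimination

variable {K : Type u} [Field K] {σ : Type*}

/-- If, modulo `I`, every variable times `X x` is a polynomial in the variables of `s`, then so is
every polynomial times a power of `X x`. -/
theorem exists_X_pow_mul_sub_mem {I : Ideal (MvPolynomial σ K)} {x : σ} {s : Set σ} (hx : x ∈ s)
    (h : ∀ y, ∃ g ∈ supported K s, X x * X y - g ∈ I) (P : MvPolynomial σ K) :
    ∃ N : ℕ, ∃ g ∈ supported K s, X x ^ N * P - g ∈ I := by
  have hX : (X x : MvPolynomial σ K) ∈ supported K s := X_mem_supported.2 hx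
  induction P using MvPolynomial.induction_on with
  | C a => exact ⟨0, C a, (supported K s).algebraMap_mem a, by simp⟩
  | add p q hp hq =>
    obtain ⟨M, f, hf, hf'⟩ := hp
    obtain ⟨N, g, hg, hg'⟩ := hq
    refine ⟨M + N, X x ^ N * f + X x ^ M * g, add_mem (mul_mem (pow_mem hX _) hf)
      (mul_mem (pow_mem hX _) hg), ?_⟩
    have : X x ^ (M + N) * (p + q) - (X x ^ N * f + X x ^ M * g) =
        X x ^ N * (X x ^ M * p - f) + X x ^ M * (X x ^ N * q - g) := by ring
    rw [this]
    exact add_mem (I.mul_mem_left _ hf') (I.mul_mem_left _ hg')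
  | mul_X p y hp =>
    obtain ⟨M, f, hf, hf'⟩ := hp
    obtain ⟨g, hg, hg'⟩ := h y
    refine ⟨M + 1, f * g, mul_mem hf hg, ?_⟩
    have : X x ^ (M + 1) * (p * X y) - f * g =
        X x * X y * (X x ^ M * p - f) + f * (X x * X y - g) := by ring
    rw [this]
    exact add_mem (I.mul_mem_left _ hf') (I.mul_mem_left _ hg')

theorem eval_eq_of_mem_supported {s : Set σ} {g : MvPolynomial σ K} (hg : g ∈ supported K s)
    {z z' : σ → K} (h : ∀ y ∈ s, z' y = z y) : eval z' g = eval z g :=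
  eval₂Hom_congr' rfl (fun y hy _ => h y (mem_supported.1 hg hy)) rfl

/-- A polynomial vanishing on sufficiently many zeros of `I` lies in `I`, if the open set
`X x ≠ 0` of the zero locus is parametrized by the coordinates in `s`. -/
theorem mem_ideal_of_vanishing [Infinite K] {I : Ideal (MvPolynomial σ K)} {x : σ} {s : Set σ}
    (hx : x ∈ s) (h : ∀ y, ∃ g ∈ supported K s, X x * X y - g ∈ I)
    (hnzd : ∀ f, X x * f ∈ I → f ∈ I) {P : MvPolynomial σ K}
    (hP : ∀ z : σ → K, z x ≠ 0 →
      ∃ z' : σ → K, (∀ y ∈ s, z' y = z y) ∧ (∀ f ∈ I, eval z' f = 0) ∧ eval z' P = 0) :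
    P ∈ I := by
  obtain ⟨N, g, hg, hg'⟩ := exists_X_pow_mul_sub_mem hx h P
  -- As `g` involves only coordinates in `s`, its value at `z` equals its value at the zero `z'` of
  -- `I`, where $P$ vanishes too. The factor $X_x$ covers the points with $z_x=0$.
  have hg0 : X x * g = 0 := by
    refine MvPolynomial.funext fun z => ?_
    by_cases hz : z x = 0
    · simp [hz]
    · obtain ⟨z', h1, h2, h3⟩ := hP z hz
      have h4 := h2 _ hg'
      rw [map_sub, map_mul, h3, mul_zero, zero_sub, neg_eq_zero,
        eval_eq_of_mem_supported hg h1] at h4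
      simp [h4]
  have hg1 : g = 0 := (mul_eq_zero.1 hg0).resolve_left (X_ne_zero x)
  rw [hg1, sub_zero] at hg'
  clear hg0 hg
  induction N with
  | zero => simpa using hg'
  | succ N ih => exact ih (hnzd _ (by rwa [pow_succ', mul_assoc] at hg'))

end Elimination

/-! ### First and second fundamental theorems, and irredundancy. -/

section FundamentalTheorems

variable {K : Type u} [Field K]

/-- The brackets of five vectors. -/
def bracketPoint {S : Type*} [CommRing S] (v : Fin 5 → Fin 2 → S) : Pair → S :=
  fun p => v p.1.1 0 * v p.1.2 1 - v p.1.1 1 * v p.1.2 0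

theorem pfVec_bracketPoint {S : Type*} [CommRing S] (v : Fin 5 → Fin 2 → S) (h : Fin 5) :
    pfVec (bracketPoint v) h = 0 := by
  rw [pfVec_eq]
  fin_cases h <;> simp [bracketPoint] <;> ring

variable (K) in
/-- The ideal of the Pfaffians. -/
def pfIdeal : Ideal (MvPolynomial Pair K) := Ideal.span (Set.range (pfVec X))

theorem genericPoint_empty : genericPoint K ∅ = X := by
  funext p
  simp [genericPoint]

theorem pfVec_mem_pfIdeal (h : Fin 5) : pfVec X h ∈ pfIdeal K := Ideal.subset_span ⟨h, rfl⟩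

theorem mem_pfIdeal_of_X_mul_mem {f : MvPolynomial Pair K} (hf : X (pr 0 1) * f ∈ pfIdeal K) :
    f ∈ pfIdeal K := by
  rw [pfIdeal, ← genericPoint_empty] at hf ⊢
  exact mem_span_pfVec_of_X_mul_mem (by rw [insert_empty_eq]; exact middleExact_singleton) hf

theorem eval_bracketPoint_of_mem_pfIdeal (v : Fin 5 → Fin 2 → K) {f : MvPolynomial Pair K}
    (hf : f ∈ pfIdeal K) : eval (bracketPoint v) f = 0 := by
  have : pfIdeal K ≤ RingHom.ker (eval (bracketPoint v)) := by
    rw [pfIdeal, Ideal.span_le]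
    rintro _ ⟨h, rfl⟩
    rw [SetLike.mem_coe, RingHom.mem_ker, map_pfVec]
    simpa using pfVec_bracketPoint v h
  exact this hf

theorem pfVec_X_one : pfVec (X : Pair → MvPolynomial Pair K) 1 =
    -(X (pr 0 2) * X (pr 3 4) - X (pr 0 3) * X (pr 2 4) + X (pr 0 4) * X (pr 2 3)) := by
  simp [pfVec_eq]

theorem pfVec_X_two : pfVec (X : Pair → MvPolynomial Pair K) 2 =
    X (pr 0 1) * X (pr 3 4) - X (pr 0 3) * X (pr 1 4) + X (pr 0 4) * X (pr 1 3) := by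
  simp [pfVec_eq]

theorem pfVec_X_three : pfVec (X : Pair → MvPolynomial Pair K) 3 =
    -(X (pr 0 1) * X (pr 2 4) - X (pr 0 2) * X (pr 1 4) + X (pr 0 4) * X (pr 1 2)) := by
  simp [pfVec_eq]

theorem pfVec_X_four : pfVec (X : Pair → MvPolynomial Pair K) 4 =
    X (pr 0 1) * X (pr 2 3) - X (pr 0 2) * X (pr 1 3) + X (pr 0 3) * X (pr 1 2) := by
  simp [pfVec_eq]

theorem forall_pair {P : Pair → Prop} (h01 : P (pr 0 1)) (h02 : P (pr 0 2)) (h03 : P (pr 0 3))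
    (h04 : P (pr 0 4)) (h12 : P (pr 1 2)) (h13 : P (pr 1 3)) (h14 : P (pr 1 4))
    (h23 : P (pr 2 3)) (h24 : P (pr 2 4)) (h34 : P (pr 3 4)) (p : Pair) : P p := by
  obtain ⟨⟨i, j⟩, hij⟩ := p
  fin_cases i <;> fin_cases j <;> first | assumption | exact absurd hij (by decide)

/-- Second fundamental theorem: a polynomial vanishing at all brackets of five vectors lies in the
ideal of the Pfaffians. -/
theorem mem_pfIdeal_of_vanishing [Infinite K] {P : MvPolynomial Pair K}
    (hP : ∀ v : Fin 5 → Fin 2 → K, eval (bracketPoint v) P = 0) : P ∈ pfIdeal K := by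
  refine mem_ideal_of_vanishing (x := pr 0 1)
    (s := {pr 0 1, pr 0 2, pr 0 3, pr 0 4, pr 1 2, pr 1 3, pr 1 4}) (by simp) ?_
    (fun f => mem_pfIdeal_of_X_mul_mem) ?_
  · have hX : ∀ y ∈ ({pr 0 1, pr 0 2, pr 0 3, pr 0 4, pr 1 2, pr 1 3, pr 1 4} : Set Pair),
        (X y : MvPolynomial Pair K) ∈
          supported K {pr 0 1, pr 0 2, pr 0 3, pr 0 4, pr 1 2, pr 1 3, pr 1 4} :=
      fun y hy => X_mem_supported.2 hy
    have hself : ∀ y ∈ ({pr 0 1, pr 0 2, pr 0 3, pr 0 4, pr 1 2, pr 1 3, pr 1 4} : Set Pair),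
        ∃ g ∈ supported K {pr 0 1, pr 0 2, pr 0 3, pr 0 4, pr 1 2, pr 1 3, pr 1 4},
          X (pr 0 1) * X y - g ∈ pfIdeal K :=
      fun y hy => ⟨X (pr 0 1) * X y, mul_mem (hX _ (by simp)) (hX y hy), by simp⟩
    -- Only $x_{23},x_{24},x_{34}$ are missing from `s`; after multiplication by $x_{01}$ three
    -- Pfaffians solve for them.
    refine forall_pair (hself _ (by simp)) (hself _ (by simp)) (hself _ (by simp))
      (hself _ (by simp)) (hself _ (by simp)) (hself _ (by simp)) (hself _ (by simp)) ?_ ?_ ?_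
    · refine ⟨X (pr 0 2) * X (pr 1 3) - X (pr 0 3) * X (pr 1 2),
        sub_mem (mul_mem (hX _ (by simp)) (hX _ (by simp)))
          (mul_mem (hX _ (by simp)) (hX _ (by simp))), ?_⟩
      convert pfVec_mem_pfIdeal (K := K) 4 using 1
      rw [pfVec_X_four]; ring
    · refine ⟨X (pr 0 2) * X (pr 1 4) - X (pr 0 4) * X (pr 1 2),
        sub_mem (mul_mem (hX _ (by simp)) (hX _ (by simp)))
          (mul_mem (hX _ (by simp)) (hX _ (by simp))), ?_⟩
      convert neg_mem (pfVec_mem_pfIdeal (K := K) 3) using 1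
      rw [pfVec_X_three]; ring
    · refine ⟨X (pr 0 3) * X (pr 1 4) - X (pr 0 4) * X (pr 1 3),
        sub_mem (mul_mem (hX _ (by simp)) (hX _ (by simp)))
          (mul_mem (hX _ (by simp)) (hX _ (by simp))), ?_⟩
      convert pfVec_mem_pfIdeal (K := K) 2 using 1
      rw [pfVec_X_two]; ring
  · intro z hz
    -- With the first two vectors normalized to $(1,0)$ and $(0,z_{01})$, the coordinates of the
    -- others are forced by $[0i]=z_{0i}$ and $[1i]=z_{1i}$.
    let v : Fin 5 → Fin 2 → K := ![![1, 0], ![0, z (pr 0 1)],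
      ![-z (pr 1 2) / z (pr 0 1), z (pr 0 2)], ![-z (pr 1 3) / z (pr 0 1), z (pr 0 3)],
      ![-z (pr 1 4) / z (pr 0 1), z (pr 0 4)]]
    refine ⟨bracketPoint v, ?_, fun f hf => eval_bracketPoint_of_mem_pfIdeal v hf, hP v⟩
    rintro y (rfl | rfl | rfl | rfl | rfl | rfl | rfl) <;> simp [bracketPoint, v] <;> field_simp

theorem killVar_pfVec (x : Pair) (h : Fin 5) :
    killVar x (pfVec (X : Pair → MvPolynomial Pair K) h) = pfVec (genericPoint K {x}) h := by
  have h1 := map_pfVec (killVar x : MvPolynomial Pair K →ₐ[K] _).toRingHom (genericPoint K ∅) h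
  rw [genericPoint_empty] at h1
  refine h1.trans (congrFun (congrArg pfVec ?_) h)
  have h2 := killVar_genericPoint K ∅ x
  rwa [genericPoint_empty, insert_empty_eq] at h2

/-- Working modulo $X_x$ is the same as substituting zero, which brings cancellation modulo
$I+(X_x)$ under the specialized exactness results. -/
theorem mem_pfIdeal_sup_iff {x : Pair} {f : MvPolynomial Pair K} :
    f ∈ pfIdeal K ⊔ Ideal.span {X x} ↔
      killVar x f ∈ Ideal.span (Set.range (pfVec (genericPoint K {x}))) := by
  have hsub : ∀ g : MvPolynomial Pair K, g - killVar x g ∈ pfIdeal K ⊔ Ideal.span {X x} :=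
    fun g => Ideal.mem_sup_right (Ideal.mem_span_singleton.2 (X_dvd_sub_killVar x g))
  constructor
  · intro hf
    have hle : pfIdeal K ⊔ Ideal.span {X x} ≤
        (Ideal.span (Set.range (pfVec (genericPoint K {x})))).comap
          (killVar x : MvPolynomial Pair K →ₐ[K] _).toRingHom := by
      rw [sup_le_iff, pfIdeal, Ideal.span_le, Ideal.span_le]
      constructor
      · rintro _ ⟨h, rfl⟩
        refine Ideal.mem_comap.2 ?_
        change killVar x _ ∈ _
        rw [killVar_pfVec]
        exact Ideal.subset_span ⟨h, rfl⟩
      · rintro _ rfl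
        refine Ideal.mem_comap.2 ?_
        change killVar x _ ∈ _
        rw [killVar_X_self]
        exact zero_mem _
    exact hle hf
  · intro hf
    have hle : Ideal.span (Set.range (pfVec (genericPoint K {x}))) ≤
        pfIdeal K ⊔ Ideal.span {X x} := by
      rw [Ideal.span_le]
      rintro _ ⟨h, rfl⟩
      rw [← killVar_pfVec, SetLike.mem_coe]
      have := sub_mem (Ideal.mem_sup_left (pfVec_mem_pfIdeal h)) (hsub (pfVec X h))
      rwa [sub_sub_cancel] at this
    have := add_mem (hsub f) (hle hf)
    rwa [sub_add_cancel] at this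

/-- The zero locus of `X (pr 0 1)` on the cone over the Grassmannian is reduced and irreducible. -/
theorem mem_pfIdeal_sup_of_vanishing [Infinite K] {P : MvPolynomial Pair K}
    (hP : ∀ v : Fin 5 → Fin 2 → K, bracketPoint v (pr 0 1) = 0 → eval (bracketPoint v) P = 0) :
    P ∈ pfIdeal K ⊔ Ideal.span {X (pr 0 1)} := by
  have hx01 : ∀ f, X (pr 0 1) * f ∈ pfIdeal K ⊔ Ideal.span {X (pr 0 1)} := fun f =>
    Ideal.mul_mem_right _ _ (Ideal.mem_sup_right (Ideal.mem_span_singleton_self _))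
  have hJ : ∀ h, pfVec X h ∈ pfIdeal K ⊔ Ideal.span {X (pr 0 1)} := fun h =>
    Ideal.mem_sup_left (pfVec_mem_pfIdeal h)
  refine mem_ideal_of_vanishing (x := pr 0 2)
    (s := {pr 0 2, pr 0 3, pr 0 4, pr 1 2, pr 2 3, pr 2 4}) (by simp) ?_ ?_ ?_
  · have hX : ∀ y ∈ ({pr 0 2, pr 0 3, pr 0 4, pr 1 2, pr 2 3, pr 2 4} : Set Pair),
        (X y : MvPolynomial Pair K) ∈
          supported K {pr 0 2, pr 0 3, pr 0 4, pr 1 2, pr 2 3, pr 2 4} :=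
      fun y hy => X_mem_supported.2 hy
    have hself : ∀ y ∈ ({pr 0 2, pr 0 3, pr 0 4, pr 1 2, pr 2 3, pr 2 4} : Set Pair),
        ∃ g ∈ supported K {pr 0 2, pr 0 3, pr 0 4, pr 1 2, pr 2 3, pr 2 4},
          X (pr 0 2) * X y - g ∈ pfIdeal K ⊔ Ideal.span {X (pr 0 1)} :=
      fun y hy => ⟨X (pr 0 2) * X y, mul_mem (hX _ (by simp)) (hX y hy), by simp⟩
    -- Modulo $x_{01}$, Pfaffians 4, 3 and 1 solve for $x_{02}$ times $x_{13}$, $x_{14}$ and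
    -- $x_{34}$, while $x_{01}$ itself becomes zero.
    refine forall_pair ?_ (hself _ (by simp)) (hself _ (by simp)) (hself _ (by simp))
      (hself _ (by simp)) ?_ ?_ (hself _ (by simp)) (hself _ (by simp)) ?_
    · exact ⟨0, zero_mem _, by rw [sub_zero, mul_comm]; exact hx01 _⟩
    · refine ⟨X (pr 0 3) * X (pr 1 2), mul_mem (hX _ (by simp)) (hX _ (by simp)), ?_⟩
      convert sub_mem (hx01 (X (pr 2 3))) (hJ 4) using 1
      rw [pfVec_X_four]; ring
    · refine ⟨X (pr 0 4) * X (pr 1 2), mul_mem (hX _ (by simp)) (hX _ (by simp)), ?_⟩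
      convert add_mem (hx01 (X (pr 2 4))) (hJ 3) using 1
      rw [pfVec_X_three]; ring
    · refine ⟨X (pr 0 3) * X (pr 2 4) - X (pr 0 4) * X (pr 2 3),
        sub_mem (mul_mem (hX _ (by simp)) (hX _ (by simp)))
          (mul_mem (hX _ (by simp)) (hX _ (by simp))), ?_⟩
      convert neg_mem (hJ 1) using 1
      rw [pfVec_X_one]; ring
  · intro f hf
    rw [mem_pfIdeal_sup_iff] at hf ⊢
    rw [map_mul, killVar_X, if_neg (by decide)] at hf
    exact mem_span_pfVec_of_X_mul_mem middleExact_pair hf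
  · intro z hz
    -- The second vector is parallel to the first, so $[01]=0$; vectors 0 and 2 now serve as the
    -- frame.
    let v : Fin 5 → Fin 2 → K := ![![1, 0], ![z (pr 1 2) / z (pr 0 2), 0],
      ![0, z (pr 0 2)], ![-z (pr 2 3) / z (pr 0 2), z (pr 0 3)],
      ![-z (pr 2 4) / z (pr 0 2), z (pr 0 4)]]
    have hv : bracketPoint v (pr 0 1) = 0 := by simp [bracketPoint, v]
    refine ⟨bracketPoint v, ?_, fun f hf => ?_, hP v hv⟩
    · rintro y (rfl | rfl | rfl | rfl | rfl | rfl) <;> simp [bracketPoint, v] <;> field_simp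
    · obtain ⟨g, hg, h, hh, rfl⟩ := Submodule.mem_sup.1 hf
      obtain ⟨k, rfl⟩ := Ideal.mem_span_singleton'.1 hh
      simp [eval_bracketPoint_of_mem_pfIdeal v hg, hv]

/-- Denominators can be cleared uniformly in rational expressions with denominator `X x`. -/
theorem exists_clear_denominators {σ τ : Type*} (x : σ) (q : τ → MvPolynomial σ K)
    (f : MvPolynomial τ K) :
    ∃ (N : ℕ) (G : MvPolynomial σ K), ∀ (z : σ → K) (c : τ → K),
      (∀ t, z x * c t = eval z (q t)) → z x ^ N * eval c f = eval z G := by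
  induction f using MvPolynomial.induction_on with
  | C a => exact ⟨0, C a, fun z c _ => by simp⟩
  | add p q hp hq =>
    obtain ⟨M, F, hF⟩ := hp
    obtain ⟨N, G, hG⟩ := hq
    refine ⟨M + N, X x ^ N * F + X x ^ M * G, fun z c h => ?_⟩
    simp only [map_add, map_mul, map_pow, eval_X, ← hF z c h, ← hG z c h]
    ring
  | mul_X p t hp =>
    obtain ⟨M, F, hF⟩ := hp
    refine ⟨M + 1, F * q t, fun z c h => ?_⟩
    simp only [map_mul, eval_X, ← hF z c h, ← h t]
    ring

theorem eval_aeval_brackets (v : Fin 5 → Fin 2 → K) (G : MvPolynomial Pair K) :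
    eval (fun q => v q.1 q.2) (aeval (brackets K) G : MvPolynomial (Fin 5 × Fin 2) K) =
      eval (bracketPoint v) G := by
  have h : ((MvPolynomial.aeval fun q : Fin 5 × Fin 2 => v q.1 q.2).comp
      ((invariants K 5).val.comp (aeval (brackets K)))) = aeval (bracketPoint v) := by
    refine MvPolynomial.algHom_ext fun p => ?_
    simp [brackets, bracket, bracketPoint]
  exact DFunLike.congr_fun h G

theorem invariants_ext [Infinite K] {p q : MvPolynomial (Fin 5 × Fin 2) K}
    (h : ∀ v : Fin 5 → Fin 2 → K, eval (fun q => v q.1 q.2) p = eval (fun q => v q.1 q.2) q) :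
    p = q :=
  MvPolynomial.funext fun z => h fun i b => z (i, b)

/-- Moving the first two vectors to a standard position. -/
theorem exists_specialLinear (v : Fin 5 → Fin 2 → K) (hv : bracketPoint v (pr 0 1) ≠ 0) :
    ∃ g : Matrix.SpecialLinearGroup (Fin 2) K, ∀ i,
      bracketPoint v (pr 0 1) * ((g : Matrix (Fin 2) (Fin 2) K) *ᵥ v i) 0 =
          v i 0 * v 1 1 - v i 1 * v 1 0 ∧
        ((g : Matrix (Fin 2) (Fin 2) K) *ᵥ v i) 1 = v 0 0 * v i 1 - v 0 1 * v i 0 := by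
  have hd : bracketPoint v (pr 0 1) = v 0 0 * v 1 1 - v 0 1 * v 1 0 := rfl
  -- This matrix sends `v 0` to $(1,0)$ and `v 1` to $(0,[01])$.
  refine ⟨⟨!![v 1 1 / bracketPoint v (pr 0 1), -v 1 0 / bracketPoint v (pr 0 1);
    -v 0 1, v 0 0], ?_⟩, fun i => ⟨?_, ?_⟩⟩
  · rw [det_fin_two_of]
    field_simp
    rw [hd]
    ring
  · simp only [mulVec, dotProduct, Fin.sum_univ_two, of_apply, cons_val', cons_val_zero,
      cons_val_one, cons_val_fin_one]
    field_simp
    ring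
  · simp only [mulVec, dotProduct, Fin.sum_univ_two, of_apply, cons_val', cons_val_zero,
      cons_val_one, cons_val_fin_one]
    ring

/-- First fundamental theorem, up to a power of the bracket `[0 1]`. -/
theorem exists_bracket_pow_mul_eq [Infinite K] (f : invariants K 5) :
    ∃ (N : ℕ) (G : MvPolynomial Pair K),
      brackets K (pr 0 1) ^ N * f = aeval (brackets K) G := by
  obtain ⟨N, G, hG⟩ := exists_clear_denominators (pr 0 1)
    -- These entries are $[01]$ times the coordinates $[i1]/[01]$ and $[0i]$ of the normalized
    -- vectors.
    (fun t : Fin 5 × Fin 2 => ![![X (pr 0 1), 0], ![0, X (pr 0 1) * X (pr 0 1)],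
      ![-X (pr 1 2), X (pr 0 1) * X (pr 0 2)], ![-X (pr 1 3), X (pr 0 1) * X (pr 0 3)],
      ![-X (pr 1 4), X (pr 0 1) * X (pr 0 4)]] t.1 t.2)
    (f : MvPolynomial (Fin 5 × Fin 2) K)
  -- The extra factor makes both sides vanish where $[01]=0$ and normalization is impossible.
  refine ⟨N + 1, X (pr 0 1) * G, Subtype.ext (invariants_ext fun v => ?_)⟩
  have hb : eval (fun q => v q.1 q.2) (brackets K (pr 0 1) : MvPolynomial (Fin 5 × Fin 2) K) =
      bracketPoint v (pr 0 1) := by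
    simp [brackets, bracket, bracketPoint]
  rw [eval_aeval_brackets]
  simp only [MulMemClass.coe_mul, SubmonoidClass.coe_pow, map_mul, map_pow, hb, eval_X]
  by_cases hv : bracketPoint v (pr 0 1) = 0
  · simp [hv]
  · obtain ⟨g, hg⟩ := exists_specialLinear v hv
    have h1 := hG (bracketPoint v)
      (fun q => ((g : Matrix (Fin 2) (Fin 2) K) *ᵥ v q.1) q.2) (by
        rintro ⟨i, b⟩
        fin_cases b
        · refine (hg i).1.trans ?_
          fin_cases i <;> simp [bracketPoint] <;> ring
        · simp only [Fin.mk_one, (hg i).2]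
          fin_cases i <;> simp [bracketPoint]
          exact Or.inr (by ring))
    rw [f.2 g v] at h1
    rw [← h1]
    ring

theorem bracket_zero_one_ne_zero : brackets K (pr 0 1) ≠ 0 := by
  intro h
  have := congrArg (fun f : invariants K 5 =>
    eval (fun q => (![![1, 0], ![0, 1], 0, 0, 0] : Fin 5 → Fin 2 → K) q.1 q.2)
      (f : MvPolynomial (Fin 5 × Fin 2) K)) h
  simp [brackets, bracket] at this

/-- First fundamental theorem: the brackets generate the algebra of invariants. -/
theorem aeval_brackets_surjective [Infinite K] :
    Function.Surjective (aeval (brackets K) : MvPolynomial Pair K →ₐ[K] invariants K 5) := by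
  intro f
  obtain ⟨N, G, hG⟩ := exists_bracket_pow_mul_eq f
  induction N generalizing G with
  | zero => exact ⟨G, by rw [← hG, pow_zero, one_mul]⟩
  | succ N ih =>
    have hmem : G ∈ pfIdeal K ⊔ Ideal.span {X (pr 0 1)} := by
      refine mem_pfIdeal_sup_of_vanishing fun v hv => ?_
      rw [← eval_aeval_brackets, ← hG]
      have hb : eval (fun q => v q.1 q.2)
          (brackets K (pr 0 1) : MvPolynomial (Fin 5 × Fin 2) K) = 0 := by
        rw [← hv]
        simp [brackets, bracket, bracketPoint]
      simp [hb]
    obtain ⟨g, hg, h, hh, rfl⟩ := Submodule.mem_sup.1 hmem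
    obtain ⟨k, rfl⟩ := Ideal.mem_span_singleton'.1 hh
    have hg0 : aeval (brackets K) g = 0 := Subtype.ext (invariants_ext fun v => by
      rw [eval_aeval_brackets, eval_bracketPoint_of_mem_pfIdeal v hg]
      simp)
    refine ih k (mul_left_cancel₀ bracket_zero_one_ne_zero ?_)
    rw [← mul_assoc, ← pow_succ', hG, map_add, hg0, zero_add, map_mul, aeval_X, mul_comm]

theorem ker_aeval_brackets [Infinite K] :
    RingHom.ker (aeval (brackets K) : MvPolynomial Pair K →ₐ[K] invariants K 5) = pfIdeal K := by
  ext G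
  rw [RingHom.mem_ker]
  constructor
  · intro h
    refine mem_pfIdeal_of_vanishing fun v => ?_
    rw [← eval_aeval_brackets, h]
    simp
  · intro h
    refine Subtype.ext (invariants_ext fun v => ?_)
    rw [eval_aeval_brackets, eval_bracketPoint_of_mem_pfIdeal v h]
    simp

theorem pfVec_X_eq (h : Fin 5) : pfVec X h = (-1) ^ (h : ℕ) * plucker K h := rfl

theorem pfIdeal_eq_span_plucker : pfIdeal K = Ideal.span (Set.range (plucker K)) := by
  refine le_antisymm (Ideal.span_le.2 ?_) (Ideal.span_le.2 ?_)
  · rintro _ ⟨h, rfl⟩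
    rw [pfVec_X_eq]
    exact Ideal.mul_mem_left _ _ (Ideal.subset_span ⟨h, rfl⟩)
  · rintro _ ⟨h, rfl⟩
    have : plucker K h = (-1) ^ (h : ℕ) * pfVec X h := by
      rw [pfVec_X_eq, ← mul_assoc, ← mul_pow]
      simp
    rw [this]
    exact Ideal.mul_mem_left _ _ (pfVec_mem_pfIdeal h)

theorem plucker_notMem (h : Fin 5) : plucker K h ∉ Ideal.span (plucker K '' {h}ᶜ) := by
  intro hmem
  -- Every term of another relation involves the index `h` and vanishes here, while the relation
  -- omitting `h` takes the value $1-1+1$.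
  let z : Pair → K := fun p => if p.1.1 = h ∨ p.1.2 = h then 0 else 1
  have heval : ∀ k, eval z (plucker K k) = (-1) ^ (k : ℕ) * pfVec z k := by
    intro k
    have h1 := map_pfVec (eval z) X k
    simp only [eval_X] at h1
    rw [← h1, pfVec_X_eq, map_mul, ← mul_assoc, map_pow, map_neg, map_one, ← mul_pow]
    simp
  have hle : Ideal.span (plucker K '' {h}ᶜ) ≤ RingHom.ker (eval z) := by
    rw [Ideal.span_le]
    rintro _ ⟨k, hk, rfl⟩
    rw [SetLike.mem_coe, RingHom.mem_ker, heval, pfVec_eq]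
    fin_cases h <;> fin_cases k <;> simp [z] at hk ⊢
  have h0 : eval z (plucker K h) = 0 := hle hmem
  rw [heval, pfVec_eq] at h0
  fin_cases h <;> simp [z] at h0

theorem brackets_notMem (p : Pair) : brackets K p ∉ Algebra.adjoin K (brackets K '' {p}ᶜ) := by
  intro hmem
  -- The two vectors of `p` are the standard basis and the rest are zero, so `p` indexes the only
  -- nonzero bracket. Evaluation here and at the origin agree on the algebra generated by the other
  -- brackets.
  let v : Fin 5 → Fin 2 → K := fun i b =>
    if (i = p.1.1 ∧ b = 0) ∨ (i = p.1.2 ∧ b = 1) then 1 else 0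
  let φ : invariants K 5 →ₐ[K] K := (aeval fun q => v q.1 q.2).comp (invariants K 5).val
  let ψ : invariants K 5 →ₐ[K] K := (aeval fun _ => 0).comp (invariants K 5).val
  have hφ : ∀ q, φ (brackets K q) = bracketPoint v q := fun q => by
    simp [φ, brackets, bracket, bracketPoint]
  have hψ : ∀ q, ψ (brackets K q) = 0 := fun q => by
    simp [ψ, brackets, bracket]
  have hle : Algebra.adjoin K (brackets K '' {p}ᶜ) ≤ AlgHom.equalizer φ ψ := by
    refine Algebra.adjoin_le ?_
    rintro _ ⟨q, hq, rfl⟩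
    change φ _ = ψ _
    rw [hφ, hψ]
    revert hq
    obtain ⟨⟨i, j⟩, hij⟩ := p
    obtain ⟨⟨k, l⟩, hkl⟩ := q
    intro hq
    simp only [Set.mem_compl_iff, Set.mem_singleton_iff, Subtype.mk.injEq, Prod.mk.injEq] at hq
    simp [bracketPoint, v]
    grind
  have h := hle hmem
  change φ _ = ψ _ at h
  rw [hφ, hψ] at h
  have hne := p.2.ne
  simp [bracketPoint, v, hne] at h

theorem brackets_isHomogeneous (p : Pair) :
    (brackets K p : MvPolynomial (Fin 5 × Fin 2) K).IsHomogeneous 2 :=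
  ((isHomogeneous_X K _).mul (isHomogeneous_X K _)).sub
    ((isHomogeneous_X K _).mul (isHomogeneous_X K _))

theorem adjoin_brackets [Infinite K] : Algebra.adjoin K (Set.range (brackets K)) = ⊤ := by
  rw [Algebra.adjoin_range_eq_range_aeval, AlgHom.range_eq_top]
  exact aeval_brackets_surjective

theorem isMinimalGenerators_brackets [Infinite K] :
    IsMinimalGenerators (brackets K) (fun _ => 2) :=
  ⟨brackets_isHomogeneous, adjoin_brackets, brackets_notMem⟩

end FundamentalTheorems

/-! ### The quadratic part of an invariant. -/

section QuadraticPart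

variable {K : Type u} [Field K]

/-- The second partial derivative at the origin of an invariant. -/
def secondDeriv (a b : Fin 5 × Fin 2) : invariants K 5 →ₗ[K] K :=
  (MvPolynomial.lcoeff K 0) ∘ₗ (pderiv a).toLinearMap ∘ₗ (pderiv b).toLinearMap ∘ₗ
    (invariants K 5).val.toLinearMap

theorem secondDeriv_apply (a b : Fin 5 × Fin 2) (x : invariants K 5) :
    secondDeriv a b x =
      constantCoeff (pderiv a (pderiv b (x : MvPolynomial (Fin 5 × Fin 2) K))) := rfl

theorem mem_adjoin_brackets [Infinite K] (x : invariants K 5) :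
    x ∈ Algebra.adjoin K (Set.range (brackets K)) := by
  rw [adjoin_brackets]
  exact Algebra.mem_top

theorem constantCoeff_pderiv_eq_zero [Infinite K] (a : Fin 5 × Fin 2) (x : invariants K 5) :
    constantCoeff (pderiv a (x : MvPolynomial (Fin 5 × Fin 2) K)) = 0 := by
  have hx := mem_adjoin_brackets x
  induction hx using Algebra.adjoin_induction with
  | mem x hx =>
    obtain ⟨p, rfl⟩ := hx
    simp [brackets, bracket]
  | algebraMap r => simp [MvPolynomial.algebraMap_eq]
  | add x y _ _ hx hy => simp [hx, hy]
  | mul x y _ _ hx hy => simp [hx, hy]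

/-- The cross terms of the Leibniz rule are products of first derivatives at the origin. They vanish
because invariants, being polynomials in quadratic brackets, have no linear part. -/
theorem secondDeriv_mul [Infinite K] (a b : Fin 5 × Fin 2) (x y : invariants K 5) :
    secondDeriv a b (x * y) =
      constantCoeff (x : MvPolynomial (Fin 5 × Fin 2) K) * secondDeriv a b y +
        secondDeriv a b x * constantCoeff (y : MvPolynomial (Fin 5 × Fin 2) K) := by
  simp [secondDeriv_apply, constantCoeff_pderiv_eq_zero, mul_comm]

theorem secondDeriv_algebraMap (a b : Fin 5 × Fin 2) (r : K) :
    secondDeriv a b (algebraMap K (invariants K 5) r) = 0 := by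
  simp [secondDeriv_apply, MvPolynomial.algebraMap_eq]

/-- For $i<j$ the monomial $a_{i0}a_{j1}$ occurs in $[ij]$ and in no other bracket with increasing
indices. -/
theorem secondDeriv_brackets (p q : Pair) :
    secondDeriv (p.1.1, 0) (p.1.2, 1) (brackets K q) = if p = q then 1 else 0 := by
  obtain ⟨⟨i, j⟩, hij⟩ := p
  obtain ⟨⟨k, l⟩, hkl⟩ := q
  simp [secondDeriv_apply, brackets, bracket, pderiv_X, Pi.single_apply]
  by_cases h1 : l = j <;> by_cases h2 : k = j <;>
    simp [h1, h2, pderiv_X, Pi.single_apply] <;> grind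

/-- The coordinates of the quadratic part of an invariant with respect to the brackets. -/
def quadPart : invariants K 5 →ₗ[K] (Pair → K) :=
  LinearMap.pi fun p => secondDeriv (p.1.1, 0) (p.1.2, 1)

theorem quadPart_apply (x : invariants K 5) (p : Pair) :
    quadPart x p = secondDeriv (p.1.1, 0) (p.1.2, 1) x := rfl

theorem quadPart_mul [Infinite K] (x y : invariants K 5) :
    quadPart (x * y) = constantCoeff (x : MvPolynomial (Fin 5 × Fin 2) K) • quadPart y +
        constantCoeff (y : MvPolynomial (Fin 5 × Fin 2) K) • quadPart x := by
  funext p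
  simp [quadPart_apply, secondDeriv_mul, mul_comm]

theorem secondDeriv_eq_sum [Infinite K] (a b : Fin 5 × Fin 2) (x : invariants K 5) :
    secondDeriv a b x = ∑ p, quadPart x p * secondDeriv a b (brackets K p) := by
  have hx := mem_adjoin_brackets x
  induction hx using Algebra.adjoin_induction with
  | mem x hx =>
    obtain ⟨q, rfl⟩ := hx
    simp [quadPart_apply, secondDeriv_brackets]
  | algebraMap r => simp [quadPart_apply, secondDeriv_algebraMap]
  | add x y _ _ hx hy =>
    rw [map_add, map_add, hx, hy, ← Finset.sum_add_distrib]
    exact Finset.sum_congr rfl fun p _ => (add_mul _ _ _).symm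
  | mul x y _ _ hx hy =>
    rw [secondDeriv_mul, quadPart_mul, hx, hy, Finset.mul_sum, Finset.sum_mul,
      ← Finset.sum_add_distrib]
    refine Finset.sum_congr rfl fun p _ => ?_
    simp only [Pi.add_apply, Pi.smul_apply, smul_eq_mul]
    ring

theorem quadPart_eq_zero_of_isHomogeneous {n : ℕ} (hn : n ≠ 2) {x : invariants K 5}
    (hx : (x : MvPolynomial (Fin 5 × Fin 2) K).IsHomogeneous n) : quadPart x = 0 := by
  funext p
  rw [quadPart_apply, secondDeriv_apply]
  have h1 := hx.pderiv (i := (p.1.2, (1 : Fin 2)))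
  -- Degrees drop by truncated subtraction, so for $n\le1$ the first derivative is treated
  -- separately as a constant.
  by_cases h : n ≤ 1
  · rw [Nat.sub_eq_zero_of_le h, ← totalDegree_zero_iff_isHomogeneous,
      totalDegree_eq_zero_iff_eq_C] at h1
    rw [h1]
    simp
  · have h2 := h1.pderiv (i := (p.1.1, (0 : Fin 2)))
    refine h2.coeff_eq_zero ?_
    rw [map_zero]
    omega

/-- Euler's identity $\sum x_a\,\partial_a g=n\,g$, with $n$ invertible in characteristic zero. -/
theorem eq_zero_of_pderiv_eq_zero [CharZero K] {τ : Type*} [Fintype τ] {n : ℕ} (hn : n ≠ 0)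
    {g : MvPolynomial τ K} (hg : g.IsHomogeneous n) (h : ∀ a, pderiv a g = 0) : g = 0 := by
  have e := hg.sum_X_mul_pderiv
  simp only [h, mul_zero, Finset.sum_const_zero] at e
  rw [nsmul_eq_mul] at e
  exact (mul_eq_zero.1 e.symm).resolve_left (by exact_mod_cast hn)

theorem eq_zero_of_quadPart_eq_zero [CharZero K] {x : invariants K 5}
    (hx : (x : MvPolynomial (Fin 5 × Fin 2) K).IsHomogeneous 2) (h : quadPart x = 0) : x = 0 := by
  refine Subtype.ext (eq_zero_of_pderiv_eq_zero two_ne_zero hx fun b => ?_)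
  refine eq_zero_of_pderiv_eq_zero one_ne_zero hx.pderiv fun a => ?_
  have h0 := (hx.pderiv (i := b)).pderiv (i := a)
  rw [← totalDegree_zero_iff_isHomogeneous, totalDegree_eq_zero_iff_eq_C] at h0
  rw [h0]
  have h1 := secondDeriv_eq_sum a b x
  rw [h] at h1
  have h2 : coeff 0 (pderiv a (pderiv b (x : MvPolynomial (Fin 5 × Fin 2) K))) = 0 :=
    h1.trans (by simp)
  rw [h2, C_0]

end QuadraticPart

/-! ### Arbitrary minimal systems of generators compared with the brackets. -/

section MinimalGenerators

variable {K : Type u} [Field K]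

theorem IsMinimalGenerators.linearIndependent {τ σ : Type*} {A : Subalgebra K (MvPolynomial τ K)}
    {f : σ → A} {deg : σ → ℕ} (hf : IsMinimalGenerators f deg) : LinearIndependent K f := by
  rw [linearIndependent_iff_notMem_span]
  intro s hs
  refine hf.irredundant s ?_
  rw [← Set.compl_eq_univ_sdiff] at hs
  exact Algebra.span_le_adjoin K _ hs

theorem isHomogeneous_of_mem_span {S : Set (invariants K 5)} {n : ℕ}
    (hS : ∀ x ∈ S, (x : MvPolynomial (Fin 5 × Fin 2) K).IsHomogeneous n) {x : invariants K 5}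
    (hx : x ∈ Submodule.span K S) : (x : MvPolynomial (Fin 5 × Fin 2) K).IsHomogeneous n := by
  have hle : Submodule.span K S ≤
      (homogeneousSubmodule (Fin 5 × Fin 2) K n).comap (invariants K 5).val.toLinearMap :=
    Submodule.span_le.2 hS
  exact hle hx

theorem isHomogeneous_one_of_mem_span_X {τ : Type*} {P : MvPolynomial τ K}
    (hP : P ∈ Submodule.span K (Set.range (X : τ → MvPolynomial τ K))) : P.IsHomogeneous 1 := by
  have hle : Submodule.span K (Set.range (X : τ → MvPolynomial τ K)) ≤
      homogeneousSubmodule τ K 1 := by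
    rw [Submodule.span_le]
    rintro _ ⟨t, rfl⟩
    exact isHomogeneous_X K t
  exact hle hP

theorem aeval_mem_span_X {τ ρ : Type*} {x : τ → MvPolynomial ρ K}
    (hx : ∀ t, x t ∈ Submodule.span K (Set.range (X : ρ → MvPolynomial ρ K)))
    {P : MvPolynomial τ K}
    (hP : P ∈ Submodule.span K (Set.range (X : τ → MvPolynomial τ K))) :
    aeval x P ∈ Submodule.span K (Set.range (X : ρ → MvPolynomial ρ K)) := by
  have hle : Submodule.span K (Set.range (X : τ → MvPolynomial τ K)) ≤
      (Submodule.span K (Set.range (X : ρ → MvPolynomial ρ K))).comap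
        (aeval x : MvPolynomial τ K →ₐ[K] _).toLinearMap := by
    rw [Submodule.span_le]
    rintro _ ⟨t, rfl⟩
    simpa using hx t
  exact hle hP

theorem eq_zero_of_aeval_eq_zero_of_mem_span_X {τ B : Type*} [Finite τ] [CommRing B] [Algebra K B]
    {g : τ → B} (hg : LinearIndependent K g) {P : MvPolynomial τ K}
    (hP : P ∈ Submodule.span K (Set.range (X : τ → MvPolynomial τ K))) (h : aeval g P = 0) :
    P = 0 := by
  have := Fintype.ofFinite τ
  obtain ⟨c, rfl⟩ := (Submodule.mem_span_range_iff_exists_fun K).1 hP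
  rw [map_sum] at h
  simp only [map_smul, aeval_X] at h
  have hc := Fintype.linearIndependent_iff.1 hg c h
  simp [hc]

theorem exists_mem_span_X_aeval_eq {τ B : Type*} [Finite τ] [CommRing B] [Algebra K B]
    {g : τ → B} {b : B} (hb : b ∈ Submodule.span K (Set.range g)) :
    ∃ P ∈ Submodule.span K (Set.range (X : τ → MvPolynomial τ K)), aeval g P = b := by
  have := Fintype.ofFinite τ
  obtain ⟨c, rfl⟩ := (Submodule.mem_span_range_iff_exists_fun K).1 hb
  refine ⟨∑ t, c t • X t, sum_mem fun t _ =>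
    Submodule.smul_mem _ _ (Submodule.subset_span ⟨t, rfl⟩), ?_⟩
  simp [map_sum]

variable [CharZero K] {σ : Type*} {f : σ → invariants K 5} {deg : σ → ℕ}

/-- By the product rule, the quadratic part of a product is a scalar combination of those of its
factors, and generators of degree other than 2 contribute nothing. -/
theorem IsMinimalGenerators.quadPart_mem_span (hf : IsMinimalGenerators f deg)
    (x : invariants K 5) :
    quadPart x ∈ (Submodule.span K (f '' {s | deg s = 2})).map quadPart := by
  have hx : x ∈ Algebra.adjoin K (Set.range f) := hf.generates ▸ Algebra.mem_top
  induction hx using Algebra.adjoin_induction with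
  | mem x hx =>
    obtain ⟨s, rfl⟩ := hx
    by_cases hs : deg s = 2
    · exact Submodule.mem_map_of_mem (Submodule.subset_span ⟨s, hs, rfl⟩)
    · rw [quadPart_eq_zero_of_isHomogeneous hs (hf.homogeneous s)]
      exact zero_mem _
  | algebraMap r =>
    have : quadPart (algebraMap K (invariants K 5) r) = 0 := by
      funext p
      exact secondDeriv_algebraMap _ _ r
    rw [this]
    exact zero_mem _
  | add x y _ _ hx hy => rw [map_add]; exact add_mem hx hy
  | mul x y _ _ hx hy =>
    rw [quadPart_mul]
    exact add_mem (Submodule.smul_mem _ _ hy) (Submodule.smul_mem _ _ hx)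

theorem IsMinimalGenerators.mem_span (hf : IsMinimalGenerators f deg) {x : invariants K 5}
    (hx : (x : MvPolynomial (Fin 5 × Fin 2) K).IsHomogeneous 2) :
    x ∈ Submodule.span K (f '' {s | deg s = 2}) := by
  obtain ⟨y, hy, hxy⟩ := hf.quadPart_mem_span x
  have hy2 : (y : MvPolynomial (Fin 5 × Fin 2) K).IsHomogeneous 2 :=
    isHomogeneous_of_mem_span (by
      rintro _ ⟨s, hs, rfl⟩
      have := hf.homogeneous s
      rwa [show deg s = 2 from hs] at this) hy
  have h0 : y - x = 0 :=
    eq_zero_of_quadPart_eq_zero (hy2.sub hx) (by rw [map_sub, hxy, sub_self])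
  rwa [← sub_eq_zero.1 h0]

/-- The degree-2 generators span the brackets and so generate everything; a generator of any other
degree would be redundant. -/
theorem IsMinimalGenerators.deg_eq_two (hf : IsMinimalGenerators f deg) (s : σ) :
    deg s = 2 := by
  by_contra hs
  refine hf.irredundant s ?_
  have hle : Algebra.adjoin K (Set.range (brackets K)) ≤ Algebra.adjoin K (f '' {s}ᶜ) := by
    refine Algebra.adjoin_le ?_
    rintro _ ⟨p, rfl⟩
    refine Algebra.span_le_adjoin K _ (Submodule.span_mono (Set.image_mono ?_)
      (hf.mem_span (brackets_isHomogeneous p)))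
    rintro t ht rfl
    exact hs ht
  exact hle (mem_adjoin_brackets _)

theorem IsMinimalGenerators.isHomogeneous_two (hf : IsMinimalGenerators f deg) (s : σ) :
    (f s : MvPolynomial (Fin 5 × Fin 2) K).IsHomogeneous 2 := by
  have := hf.homogeneous s
  rwa [hf.deg_eq_two s] at this

theorem IsMinimalGenerators.mem_span_range (hf : IsMinimalGenerators f deg) {x : invariants K 5}
    (hx : (x : MvPolynomial (Fin 5 × Fin 2) K).IsHomogeneous 2) :
    x ∈ Submodule.span K (Set.range f) :=
  Submodule.span_mono (Set.image_subset_range _ _) (hf.mem_span hx)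

theorem IsMinimalGenerators.span_eq (hf : IsMinimalGenerators f deg) :
    Submodule.span K (Set.range f) = Submodule.span K (Set.range (brackets K)) := by
  refine le_antisymm (Submodule.span_le.2 ?_) (Submodule.span_le.2 ?_)
  · rintro _ ⟨s, rfl⟩
    exact isMinimalGenerators_brackets.mem_span_range (hf.isHomogeneous_two s)
  · rintro _ ⟨p, rfl⟩
    exact hf.mem_span_range (brackets_isHomogeneous p)

theorem IsMinimalGenerators.card_eq_ten (hf : IsMinimalGenerators f deg) : Nat.card σ = 10 := by
  have e := (Module.Basis.span hf.linearIndependent).indexEquiv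
    ((Module.Basis.span isMinimalGenerators_brackets.linearIndependent).map
      (LinearEquiv.ofEq _ _ hf.span_eq.symm))
  rw [Nat.card_congr e, Nat.card_eq_fintype_card]
  decide

/-- Two minimal systems of generators differ by a linear change of coordinates. -/
theorem IsMinimalGenerators.exists_linear_change [Finite σ] (hf : IsMinimalGenerators f deg) :
    ∃ ψ : MvPolynomial Pair K ≃ₐ[K] MvPolynomial σ K,
      (∀ p, (ψ (X p)).IsHomogeneous 1) ∧ ∀ P, aeval f (ψ P) = aeval (brackets K) P := by
  have hb := isMinimalGenerators_brackets (K := K)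
  have h1 : ∀ p, ∃ P ∈ Submodule.span K (Set.range (X : σ → MvPolynomial σ K)),
      aeval f P = brackets K p := fun p =>
    exists_mem_span_X_aeval_eq (hf.mem_span_range (brackets_isHomogeneous p))
  have h2 : ∀ s, ∃ P ∈ Submodule.span K (Set.range (X : Pair → MvPolynomial Pair K)),
      aeval (brackets K) P = f s := fun s =>
    exists_mem_span_X_aeval_eq (hb.mem_span_range (hf.isHomogeneous_two s))
  choose x hx hfx using h1
  choose y hy hby using h2
  have c1 : ∀ P : MvPolynomial Pair K, aeval f (aeval x P) = aeval (brackets K) P := by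
    intro P
    have : (aeval f).comp (aeval x : MvPolynomial Pair K →ₐ[K] MvPolynomial σ K) =
        aeval (brackets K) := algHom_ext fun p => by simp [hfx]
    exact DFunLike.congr_fun this P
  have c2 : ∀ P : MvPolynomial σ K, aeval (brackets K) (aeval y P) = aeval f P := by
    intro P
    have : (aeval (brackets K)).comp (aeval y : MvPolynomial σ K →ₐ[K] MvPolynomial Pair K) =
        aeval f := algHom_ext fun p => by simp [hby]
    exact DFunLike.congr_fun this P
  -- Each composite sends a variable to a linear form with the same image among the invariants.
  -- Linear independence of the generators makes that form equal to the variable.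
  refine ⟨AlgEquiv.ofAlgHom (aeval x) (aeval y) (algHom_ext fun s => ?_)
    (algHom_ext fun p => ?_), fun p => ?_, c1⟩
  · refine sub_eq_zero.1 (eq_zero_of_aeval_eq_zero_of_mem_span_X hf.linearIndependent
      (sub_mem ?_ (Submodule.subset_span ⟨s, rfl⟩)) ?_)
    · simpa using aeval_mem_span_X hx (hy s)
    · change aeval f (aeval x (aeval y (X s)) - X s) = 0
      rw [map_sub, c1, aeval_X, hby, aeval_X, sub_self]
  · refine sub_eq_zero.1 (eq_zero_of_aeval_eq_zero_of_mem_span_X hb.linearIndependent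
      (sub_mem ?_ (Submodule.subset_span ⟨p, rfl⟩)) ?_)
    · simpa using aeval_mem_span_X hy (hx p)
    · change aeval (brackets K) (aeval y (aeval x (X p)) - X p) = 0
      rw [map_sub, c2, aeval_X, hfx, aeval_X, sub_self]
  · simpa using isHomogeneous_one_of_mem_span_X (hx p)

end MinimalGenerators

/-! ### From matrices to exact sequences of linear maps. -/

section MatrixComplexes

variable {R : Type*} [CommRing R]

theorem MatExact.map_equiv {S ι κ μ : Type*} [CommRing S] [Fintype ι] [Fintype κ]
    {N : Matrix μ ι R} {M : Matrix ι κ R} (h : MatExact N M) (e : R ≃+* S) :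
    MatExact (N.map (e : R →+* S)) (M.map (e : R →+* S)) := by
  intro u hu
  obtain ⟨w, hw⟩ := h (fun i => e.symm (u i)) (by
    funext i
    apply e.injective
    have h1 := map_mulVec_apply (e : R →+* S) N (fun i => e.symm (u i)) i
    have h2 := congrFun hu i
    simp only [RingEquiv.coe_toRingHom, RingEquiv.apply_symm_apply] at h1
    rw [h1]
    simpa using h2)
  refine ⟨fun j => e (w j), funext fun i => ?_⟩
  have h1 := map_mulVec_apply (e : R →+* S) M w i
  rw [hw] at h1
  simpa using h1.symm

theorem MatExact.exact {ι κ μ : Type*} [Fintype ι] [Fintype κ]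
    {N : Matrix μ ι R} {M : Matrix ι κ R} (h : MatExact N M) (hNM : N * M = 0) :
    Function.Exact M.mulVecLin N.mulVecLin := by
  intro u
  constructor
  · exact h u
  · rintro ⟨w, rfl⟩
    simp [mulVec_mulVec, hNM]

theorem mulVec_mem_ideal {ι κ : Type*} [Fintype κ] {M : Matrix ι κ R} {I : Ideal R}
    (hM : ∀ i j, M i j ∈ I) (v : κ → R) (i : ι) : (M *ᵥ v) i ∈ I :=
  sum_mem fun j _ => I.mul_mem_right _ (hM i j)

theorem pfCol_injective [IsDomain R] {x : Pair → R} (hx : pfVec x 0 ≠ 0) :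
    Function.Injective (pfCol x).mulVecLin := by
  rw [injective_iff_map_eq_zero]
  intro v hv
  funext i
  have h0 := congrFun hv 0
  rw [Subsingleton.elim i 0]
  simpa [mulVec, dotProduct, pfCol, hx] using h0

end MatrixComplexes

/-! ### Weighted degrees and the irrelevant ideal. -/

section WeightedHomogeneous

variable {K : Type u} [Field K] {σ : Type*}

theorem isWeightedHomogeneous_of_isHomogeneous {P : MvPolynomial σ K} {n : ℕ}
    (hP : P.IsHomogeneous n) (k : ℤ) :
    IsWeightedHomogeneous (fun _ : σ => k) P (n * k) := by
  intro d hd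
  have h := hP hd
  rw [Finsupp.weight_apply, Finsupp.sum] at h ⊢
  simp only [Pi.one_apply, smul_eq_mul, mul_one] at h
  rw [← h]
  simp [Finset.sum_mul]

theorem isWeightedHomogeneous_aeval {τ : Type*} {M : Type*} [AddCommMonoid M] {w : σ → M}
    {w' : τ → M} {g : σ → MvPolynomial τ K} (hg : ∀ s, IsWeightedHomogeneous w' (g s) (w s))
    {P : MvPolynomial σ K} {n : M} (hP : IsWeightedHomogeneous w P n) :
    IsWeightedHomogeneous w' (aeval g P) n := by
  rw [aeval_def, eval₂_eq]
  refine IsWeightedHomogeneous.sum _ _ _ fun d hd => ?_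
  rw [MvPolynomial.algebraMap_eq]
  refine IsWeightedHomogeneous.C_mul ?_ _
  rw [← hP (mem_support_iff.1 hd), Finsupp.weight_apply, Finsupp.sum]
  exact IsWeightedHomogeneous.prod _ _ _ fun s _ => (hg s).pow _

theorem mem_span_range_X_of_isHomogeneous {P : MvPolynomial σ K} {n : ℕ} (hn : n ≠ 0)
    (hP : P.IsHomogeneous n) : P ∈ Ideal.span (Set.range (X : σ → MvPolynomial σ K)) := by
  rw [← Set.image_univ, mem_ideal_span_X_image]
  intro m hm
  by_contra! h
  have hm0 : m = 0 := by
    ext i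
    simpa using h i (Set.mem_univ i)
  have := hP (mem_support_iff.1 hm)
  rw [hm0, map_zero] at this
  exact hn this.symm

theorem mulVec_mem_freeDegree {m n : ℕ} {w : σ → ℤ} {M : Matrix (Fin m) (Fin n) (MvPolynomial σ K)}
    {a b c : ℤ} (hM : ∀ i j, IsWeightedHomogeneous w (M i j) c) (habc : c + a = b) (k : ℤ)
    {v : Fin n → MvPolynomial σ K} (hv : v ∈ freeDegree w (fun _ => b) k) :
    M *ᵥ v ∈ freeDegree w (fun _ => a) k := by
  intro i
  refine IsWeightedHomogeneous.sum _ _ _ fun j _ => ?_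
  have := (hM i j).mul (hv j)
  rwa [show c + (k - b) = k - a by omega] at this

end WeightedHomogeneous

/-! ### The minimal graded free resolution. -/

section Resolution

variable {K : Type u} [Field K] {σ : Type*}

/-- The ranks `1, 5, 5, 1` of the resolution. -/
def resRank : ℕ → ℕ
  | 0 => 1
  | 1 => 5
  | 2 => 5
  | 3 => 1
  | _ + 4 => 0

/-- The degrees `0, 4, 6, 10` of the generators in the resolution. -/
def resTwist : ℕ → ℤ
  | 0 => 0
  | 1 => 4
  | 2 => 6
  | 3 => 10
  | _ + 4 => 0

/-- The differentials of the resolution. -/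
def resD {R : Type*} [CommRing R] (x : Pair → R) :
    ∀ i, (Fin (resRank (i + 1)) → R) →ₗ[R] (Fin (resRank i) → R)
  | 0 => (pfRow x).mulVecLin
  | 1 => (skewOf x).mulVecLin
  | 2 => (pfCol x).mulVecLin
  | _ + 3 => 0

/-- The augmentation `R → A` given by `f`. -/
def augmentation {A : Type*} [CommRing A] [Algebra K A] (f : σ → A) :
    letI : Module (MvPolynomial σ K) A := moduleVia f
    (Fin 1 → MvPolynomial σ K) →ₗ[MvPolynomial σ K] A :=
  letI : Module (MvPolynomial σ K) A := moduleVia f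
  { toFun := fun v => aeval f (v 0)
    map_add' := fun v w => by simp
    map_smul' := fun r v => by
      rw [Pi.smul_apply, smul_eq_mul, map_mul]
      rfl }

theorem augmentation_apply {A : Type*} [CommRing A] [Algebra K A] (f : σ → A)
    (v : Fin 1 → MvPolynomial σ K) : augmentation f v = aeval f (v 0) := rfl

theorem augmentation_surjective {A : Type*} [CommRing A] [Algebra K A] {f : σ → A}
    (hf : Algebra.adjoin K (Set.range f) = ⊤) : Function.Surjective (augmentation (K := K) f) := by
  rw [Algebra.adjoin_range_eq_range_aeval, AlgHom.range_eq_top] at hf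
  intro a
  obtain ⟨P, hP⟩ := hf a
  exact ⟨fun _ => P, hP⟩

/-- Coordinates `x` on `R = K[σ]` in which `f` becomes the family of brackets. -/
structure BracketCoordinates (f : σ → invariants K 5) (x : Pair → MvPolynomial σ K) : Prop where
  homogeneous : ∀ p, (x p).IsHomogeneous 1
  exact_pfRow : MatExact (pfRow x) (skewOf x)
  exact_skewOf : MatExact (skewOf x) (pfCol x)
  pfVec_ne_zero : pfVec x 0 ≠ 0
  aeval_eq_zero_iff : ∀ P, aeval f P = 0 ↔ ∃ u, (pfRow x *ᵥ u) 0 = P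

theorem pfVec_X_zero_ne_zero : pfVec (X : Pair → MvPolynomial Pair K) 0 ≠ 0 := by
  intro h
  refine plucker_notMem (K := K) 0 ?_
  have : plucker K 0 = 0 := by simpa [pfVec_X_eq] using h
  rw [this]
  exact zero_mem _

/-- The linear change of coordinates is a ring isomorphism, so exactness and the description of the
kernel carry over from the generic matrix. -/
theorem IsMinimalGenerators.exists_bracketCoordinates [CharZero K] [Finite σ]
    {f : σ → invariants K 5} {deg : σ → ℕ} (hf : IsMinimalGenerators f deg) :
    ∃ x, BracketCoordinates f x := by
  obtain ⟨ψ, hψ, hfψ⟩ := hf.exists_linear_change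
  have hexact := middleExact_empty (K := K)
  rw [MiddleExact, genericPoint_empty] at hexact
  have hrow := pfRow_map ((ψ : MvPolynomial Pair K ≃+* MvPolynomial σ K) :
    MvPolynomial Pair K →+* MvPolynomial σ K) X
  have hskew := skewOf_map ((ψ : MvPolynomial Pair K ≃+* MvPolynomial σ K) :
    MvPolynomial Pair K →+* MvPolynomial σ K) X
  have hcol := pfCol_map ((ψ : MvPolynomial Pair K ≃+* MvPolynomial σ K) :
    MvPolynomial Pair K →+* MvPolynomial σ K) X
  refine ⟨fun p => ψ (X p), hψ, ?_, ?_, ?_, fun P => ?_⟩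
  · have := hexact.1.map_equiv (ψ : MvPolynomial Pair K ≃+* MvPolynomial σ K)
    rw [hrow, hskew] at this
    exact this
  · have := hexact.2.map_equiv (ψ : MvPolynomial Pair K ≃+* MvPolynomial σ K)
    rw [hcol, hskew] at this
    exact this
  · have h1 := map_pfVec ((ψ : MvPolynomial Pair K ≃+* MvPolynomial σ K) :
      MvPolynomial Pair K →+* MvPolynomial σ K) X 0
    intro h
    refine pfVec_X_zero_ne_zero (K := K) (ψ.injective ?_)
    rw [map_zero]
    exact h1.trans h
  · have h1 : aeval f P = aeval (brackets K) (ψ.symm P) := by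
      rw [← hfψ, AlgEquiv.apply_symm_apply]
    rw [h1, ← RingHom.mem_ker, ker_aeval_brackets, pfIdeal, mem_span_pfVec_iff]
    constructor
    · rintro ⟨u, hu⟩
      refine ⟨fun i => ψ (u i), ?_⟩
      have h2 := map_mulVec_apply ((ψ : MvPolynomial Pair K ≃+* MvPolynomial σ K) :
        MvPolynomial Pair K →+* MvPolynomial σ K) (pfRow X) u 0
      rw [hu, hrow] at h2
      rw [← ψ.apply_symm_apply P]
      exact h2.symm
    · rintro ⟨u, hu⟩
      refine ⟨fun i => ψ.symm (u i), ψ.injective ?_⟩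
      have h2 := map_mulVec_apply ((ψ : MvPolynomial Pair K ≃+* MvPolynomial σ K) :
        MvPolynomial Pair K →+* MvPolynomial σ K) (pfRow X) (fun i => ψ.symm (u i)) 0
      rw [hrow] at h2
      refine h2.trans ?_
      rw [ψ.apply_symm_apply, ← hu]
      simp

namespace BracketCoordinates

variable {f : σ → invariants K 5} {x : Pair → MvPolynomial σ K}

theorem exact_zero_one (hx : BracketCoordinates f x) :
    Function.Exact (skewOf x).mulVecLin (pfRow x).mulVecLin :=
  hx.exact_pfRow.exact (pfRow_mul_skewOf x)

theorem exact_one_two (hx : BracketCoordinates f x) :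
    Function.Exact (pfCol x).mulVecLin (skewOf x).mulVecLin :=
  hx.exact_skewOf.exact (skewOf_mul_pfCol x)

theorem exact_augmentation (hx : BracketCoordinates f x) :
    Function.Exact (pfRow x).mulVecLin (augmentation f) := by
  intro v
  rw [augmentation_apply, hx.aeval_eq_zero_iff]
  refine exists_congr fun u => ⟨fun h => funext fun i => ?_, fun h => congrFun h 0⟩
  rw [Subsingleton.elim i 0]
  exact h

theorem exact_resD (hx : BracketCoordinates f x) :
    ∀ i, Function.Exact (resD x (i + 1)) (resD x i)
  | 0 => hx.exact_zero_one
  | 1 => hx.exact_one_two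
  | 2 => by
    intro v
    constructor
    · intro hv
      exact ⟨0, (map_zero _).trans (pfCol_injective hx.pfVec_ne_zero
        (hv.trans (map_zero _).symm)).symm⟩
    · rintro ⟨w, rfl⟩
      exact map_zero (resD x 2)
  | i + 3 => by
    intro v
    refine ⟨fun _ => ⟨0, funext fun a => Fin.elim0 a⟩, fun _ => rfl⟩

theorem resD_mem (hx : BracketCoordinates f x) :
    ∀ i v a, resD x i v a ∈ Ideal.span (Set.range (X : σ → MvPolynomial σ K))
  | 0, v, a => mulVec_mem_ideal (fun _ j => mem_span_range_X_of_isHomogeneous two_ne_zero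
      (pfVec_isHomogeneous hx.homogeneous j)) v a
  | 1, v, a => mulVec_mem_ideal (fun i j => mem_span_range_X_of_isHomogeneous one_ne_zero
      (skewOf_isHomogeneous hx.homogeneous i j)) v a
  | 2, v, a => mulVec_mem_ideal (fun i _ => mem_span_range_X_of_isHomogeneous two_ne_zero
      (pfVec_isHomogeneous hx.homogeneous i)) v a
  | _ + 3, _, _ => zero_mem _

/-- Variables have degree 2, so the quadratic Pfaffians raise degree by 4 and the linear entries by
2, whence the twists $0,4,6,10$. -/
theorem resD_graded (hx : BracketCoordinates f x) :
    ∀ i n, Set.MapsTo (resD x i) (freeDegree (fun _ => 2) (fun _ => resTwist (i + 1)) n)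
      (freeDegree (fun _ => 2) (fun _ => resTwist i) n)
  | 0, n => fun _ hv => mulVec_mem_freeDegree (c := 4) (fun _ j =>
      isWeightedHomogeneous_of_isHomogeneous (pfVec_isHomogeneous hx.homogeneous j) 2) rfl n hv
  | 1, n => fun _ hv => mulVec_mem_freeDegree (c := 2) (fun i j =>
      isWeightedHomogeneous_of_isHomogeneous (skewOf_isHomogeneous hx.homogeneous i j) 2) rfl n hv
  | 2, n => fun _ hv => mulVec_mem_freeDegree (c := 4) (fun i _ =>
      isWeightedHomogeneous_of_isHomogeneous (pfVec_isHomogeneous hx.homogeneous i) 2) rfl n hv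
  | _ + 3, _ => fun _ _ _ => isWeightedHomogeneous_zero _ _ _

theorem isWeightedHomogeneous_augmentation (hf : IsMinimalGenerators f (fun _ => 2)) {n : ℤ}
    {v : Fin 1 → MvPolynomial σ K} (hv : IsWeightedHomogeneous (fun _ : σ => (2 : ℤ)) (v 0) n) :
    augmentation f v ∈ algebraDegree (invariants K 5) n := by
  have h1 := isWeightedHomogeneous_aeval (w' := fun _ : Fin 5 × Fin 2 => (1 : ℤ))
    (g := fun s => (f s : MvPolynomial (Fin 5 × Fin 2) K))
    (fun s => isWeightedHomogeneous_of_isHomogeneous (hf.homogeneous s) 1) hv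
  have h2 : (invariants K 5).val.comp (aeval f) =
      aeval fun s => (f s : MvPolynomial (Fin 5 × Fin 2) K) :=
    algHom_ext fun s => by simp
  rw [← h2] at h1
  exact h1

/-- The minimal graded free resolution of the algebra of invariants. -/
def resolution (hx : BracketCoordinates f x) (hf : IsMinimalGenerators f (fun _ => 2)) :
    letI : Module (MvPolynomial σ K) (invariants K 5) := moduleVia f
    MinimalGradedFreeResolution (K := K) (fun _ : σ => ((2 : ℕ) : ℤ)) (invariants K 5)
      (algebraDegree (invariants K 5)) :=
  letI : Module (MvPolynomial σ K) (invariants K 5) := moduleVia f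
  { rank := resRank
    twist := fun i _ => resTwist i
    d := resD x
    aug := augmentation f
    d_graded := hx.resD_graded
    aug_graded := fun n v hv => isWeightedHomogeneous_augmentation hf (n := n) (v := v)
      (by simpa [resTwist] using hv (0 : Fin 1))
    exact_d := hx.exact_resD
    exact_aug := hx.exact_augmentation
    aug_surjective := augmentation_surjective hf.generates
    minimal := hx.resD_mem }

end BracketCoordinates

end Resolution

/-! ### Projective dimension by dimension shifting. -/

section ProjectiveDimension

open CategoryTheory

theorem hasProjectiveDimensionLT_iff_ker {R F N : Type u} [CommRing R] [AddCommGroup F]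
    [Module R F] [AddCommGroup N] [Module R N] [Module.Projective R F] {φ : F →ₗ[R] N}
    (hφ : Function.Surjective φ) (n : ℕ) :
    HasProjectiveDimensionLT (ModuleCat.of R N) (n + 2) ↔
      HasProjectiveDimensionLT (ModuleCat.of R (LinearMap.ker φ)) (n + 1) :=
  (LinearMap.shortExact_shortComplexKer hφ).hasProjectiveDimensionLT_X₃_iff n
    ((IsProjective.iff_projective F).1 inferInstance)

theorem hasProjectiveDimensionLT_iff_of_exact {R F F' N : Type u} [CommRing R] [AddCommGroup F]
    [Module R F] [AddCommGroup F'] [Module R F'] [AddCommGroup N] [Module R N]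
    [Module.Projective R F] {φ : F →ₗ[R] N} {d : F' →ₗ[R] F}
    (hd : Function.Exact d φ) (hφ : Function.Surjective φ) (n : ℕ) :
    HasProjectiveDimensionLT (ModuleCat.of R N) (n + 2) ↔
      HasProjectiveDimensionLT (ModuleCat.of R (LinearMap.range d)) (n + 1) := by
  rw [hasProjectiveDimensionLT_iff_ker hφ n, LinearMap.exact_iff.1 hd]

theorem exact_rangeRestrict {R F F' G : Type*} [CommRing R] [AddCommGroup F]
    [Module R F] [AddCommGroup F'] [Module R F'] [AddCommGroup G] [Module R G]
    {φ : F →ₗ[R] G} {d : F' →ₗ[R] F} (hd : Function.Exact d φ) :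
    Function.Exact d φ.rangeRestrict := by
  intro v
  rw [← hd v]
  exact Subtype.ext_iff

variable {K : Type u} [Field K] {σ : Type} {f : σ → invariants K 5}
  {x : Pair → MvPolynomial σ K}

/-- Minimality: the last syzygy module is not a direct summand. -/
theorem BracketCoordinates.not_projective (hx : BracketCoordinates f x) :
    ¬ Module.Projective (MvPolynomial σ K) (LinearMap.range (skewOf x).mulVecLin) := by
  intro hproj
  obtain ⟨s, hs⟩ := Module.projective_lifting_property (skewOf x).mulVecLin.rangeRestrict
    LinearMap.id (LinearMap.surjective_rangeRestrict _)
  -- A splitting would give a projection `ρ` of the free module onto $\ker A$, which is spanned by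
  -- the Pfaffian vector.
  let ρ : (Fin 5 → MvPolynomial σ K) →ₗ[MvPolynomial σ K] (Fin 5 → MvPolynomial σ K) :=
    LinearMap.id - s ∘ₗ (skewOf x).mulVecLin.rangeRestrict
  have hρ : ∀ v, skewOf x *ᵥ ρ v = 0 := by
    intro v
    have h1 := DFunLike.congr_fun hs ((skewOf x).mulVecLin.rangeRestrict v)
    have h2 : (skewOf x).mulVecLin (s ((skewOf x).mulVecLin.rangeRestrict v)) =
        (skewOf x).mulVecLin v := congrArg Subtype.val h1
    change (skewOf x).mulVecLin (v - s ((skewOf x).mulVecLin.rangeRestrict v)) = 0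
    rw [map_sub, h2, sub_self]
  choose c hc using fun h : Fin 5 => hx.exact_skewOf _ (hρ (Pi.single h 1))
  have hp : ρ (pfVec x) = pfVec x := by
    have h0 : (skewOf x).mulVecLin.rangeRestrict (pfVec x) = 0 := by
      refine Subtype.ext (funext fun i => ?_)
      exact congrFun (congrFun (skewOf_mul_pfCol x) i) 0
    change pfVec x - s ((skewOf x).mulVecLin.rangeRestrict (pfVec x)) = pfVec x
    rw [h0, map_zero, sub_zero]
  have hsum : pfVec x = ∑ h, pfVec x h • Pi.single h (1 : MvPolynomial σ K) := by
    funext i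
    simp [Finset.sum_apply, Pi.single_apply]
  -- Writing $\rho(e_h)=c_h\,\mathrm{pf}$, the identity $\rho(\mathrm{pf})=\mathrm{pf}$ forces
  -- $\sum_h \mathrm{pf}_h c_h=1$. This is impossible at the origin, where all Pfaffians vanish.
  have h0 : (∑ h, pfVec x h * c h 0) * pfVec x 0 = 1 * pfVec x 0 := by
    have h1 := congrFun hp 0
    conv_lhs at h1 => rw [hsum, map_sum, Finset.sum_apply]
    refine Eq.trans ?_ (h1.trans (one_mul _).symm)
    rw [Finset.sum_mul]
    refine Finset.sum_congr rfl fun h _ => ?_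
    rw [map_smul, ← hc h]
    simp [mulVec, dotProduct, pfCol]
    ring
  have h1 := mul_right_cancel₀ hx.pfVec_ne_zero h0
  have h2 := congrArg constantCoeff h1
  rw [map_sum] at h2
  have h3 : ∀ h, constantCoeff (pfVec x h) = 0 := fun h =>
    (pfVec_isHomogeneous hx.homogeneous h).coeff_eq_zero (by simp)
  simp [h3] at h2

theorem BracketCoordinates.projectiveDimension_eq (hx : BracketCoordinates f x)
    (hf : Algebra.adjoin K (Set.range f) = ⊤) :
    letI : Module (MvPolynomial σ K) (invariants K 5) := moduleVia f
    projectiveDimension (ModuleCat.of (MvPolynomial σ K) (invariants K 5)) = 3 := by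
  let : Module (MvPolynomial σ K) (invariants K 5) := moduleVia f
  have e0 := hasProjectiveDimensionLT_iff_of_exact hx.exact_augmentation
    (augmentation_surjective hf)
  have e1 := hasProjectiveDimensionLT_iff_of_exact (exact_rangeRestrict hx.exact_zero_one)
    (LinearMap.surjective_rangeRestrict _)
  have e2 := hasProjectiveDimensionLT_iff_of_exact (exact_rangeRestrict hx.exact_one_two)
    (LinearMap.surjective_rangeRestrict _)
  refine le_antisymm ((projectiveDimension_le_iff _ 3).2 ?_)
    ((projectiveDimension_ge_iff _ 3).2 fun h => ?_)
  -- Three shifts reach the image of the Pfaffian column, which is free of rank one because that map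
  -- is injective. For the lower bound, two shifts reach the image of the skew matrix, which is not
  -- projective.
  · refine (e0 2).2 ((e1 1).2 ((e2 0).2 ?_))
    rw [← projective_iff_hasProjectiveDimensionLT_one, ← IsProjective.iff_projective]
    exact Module.Projective.of_equiv
      (LinearEquiv.ofInjective _ (pfCol_injective hx.pfVec_ne_zero))
  · have h1 := (e1 0).1 ((e0 1).1 h)
    rw [← projective_iff_hasProjectiveDimensionLT_one, ← IsProjective.iff_projective] at h1
    exact hx.not_projective h1

end ProjectiveDimension

end FiveLinearForms

end

theorem mainTheorem7 (K : Type*) [Field K] [CharZero K] :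
    -- the ten brackets are a minimal system of generators, of degree 2
    IsMinimalGenerators (brackets K) (fun _ => 2) ∧
    -- their relations are generated, irredundantly, by the five Plücker relations
    (RingHom.ker (aeval (brackets K) : MvPolynomial Pair K →ₐ[K] invariants K 5)
        = Ideal.span (Set.range (plucker K)) ∧
      ∀ h, plucker K h ∉ Ideal.span (plucker K '' {h}ᶜ)) ∧
    -- the minimal resolution, for every minimal system of homogeneous generators
    ∀ (σ : Type) [Finite σ] (f : σ → invariants K 5) (deg : σ → ℕ), IsMinimalGenerators f deg →
      Nat.card σ = 10 ∧ (∀ s, deg s = 2) ∧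
      letI : Module (MvPolynomial σ K) (invariants K 5) := moduleVia f
      (∃ F : MinimalGradedFreeResolution (K := K) (fun s => (deg s : ℤ)) (invariants K 5)
          (algebraDegree (invariants K 5)),
        F.TermIs 0 0 1 ∧ F.TermIs 1 4 5 ∧ F.TermIs 2 6 5 ∧ F.TermIs 3 10 1 ∧
        (∀ i, 4 ≤ i → F.rank i = 0) ∧
        ∀ a r, F.aug (Pi.single a r) = aeval f r) ∧
      CategoryTheory.projectiveDimension
        (ModuleCat.of (MvPolynomial σ K) (invariants K 5)) = 3 := by
  have : Infinite K := Infinite.of_injective _ Nat.cast_injective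
  refine ⟨isMinimalGenerators_brackets, ⟨?_, plucker_notMem⟩, fun σ _ f deg hf => ?_⟩
  · rw [ker_aeval_brackets, pfIdeal_eq_span_plucker]
  · obtain rfl : deg = fun _ => 2 := funext hf.deg_eq_two
    obtain ⟨x, hx⟩ := hf.exists_bracketCoordinates
    refine ⟨hf.card_eq_ten, fun _ => rfl, ⟨hx.resolution hf, ⟨rfl, fun _ => rfl⟩,
      ⟨rfl, fun _ => rfl⟩, ⟨rfl, fun _ => rfl⟩, ⟨rfl, fun _ => rfl⟩, ?_, fun a r => ?_⟩,
      hx.projectiveDimension_eq hf.generates⟩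
    · intro i hi
      obtain ⟨k, hk⟩ := Nat.exists_eq_add_of_le' hi
      rw [hk]
      rfl
    · obtain rfl : a = (0 : Fin 1) := Subsingleton.elim (α := Fin 1) _ _
      exact congrArg (aeval f) (Pi.single_eq_same (M := fun _ : Fin 1 => MvPolynomial σ K) 0 r)
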